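/- Let $A$ be a finite dimensional algebra over an algebraically closed field $K$, and let $\mathrm{mod}\,A$ be the category of finitely generated right $A$-modules. Let $\tau = \mathrm{Hom}_K(\mathrm{Tr}(-),K)$ be the Auslander–Reiten translation, where $\mathrm{Tr}\,X$ is the cokernel of $\mathrm{Hom}_A(P_0,A)\to \mathrm{Hom}_A(P_1,A)$ for a minimal projective presentation $P_1\to P_0\to X\to 0$. For $X\in \mathrm{mod}\,A$ let $|X|$ be the number of pairwise nonisomorphic indecomposable direct summands of $X$, let $\mathrm{Fac}\,X$ be the class of all $M\in\mathrm{mod}\,A$ admitting an epimorphism $X^n\to M$ for some $n$, and let $\mathrm{Sub}\,X$ be the class of all $N\in\mathrm{mod}\,A$ admitting a monomorphism $N\to X^n$ for some $n$. Let $T\in\mathrm{mod}\,A$ be a $\tau$-tilting module, that is, $\mathrm{Hom}_A(T,\tau T)=0$ and $|T|=|A|$. Put $B=\mathrm{End}_A(T)$ and $C=\mathrm{End}_A(\tau T)^{\mathrm{op}}$. Regard $\mathrm{Hom}_A(T,M)$ as a right $B$-module through $f\cdot b=f\circ b$, and $\mathrm{Hom}_A(N,\tau T)$ as a right $C$-module,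 i.e. as a left $\mathrm{End}_A(\tau T)$-module, through $c\cdot f=c\circ f$. Then the following hold (dimensions may be infinite, and the zero module has dimension $-\infty$). 1. For any $M\in\mathrm{Fac}\,T$ with $\mathrm{pd}_A M\le 1$, one has $\mathrm{pd}_B\,\mathrm{Hom}_A(T,M)\le \mathrm{pd}_A M$. 2. For any $M\in\mathrm{Fac}\,T$ with $\mathrm{Ext}^i_A(T,M\oplus T)=0$ for all $i\ge 1$, one has $\mathrm{pd}_B\,\mathrm{Hom}_A(T,M)\le \mathrm{pd}_A M$. 3. For any $N\in\mathrm{Sub}\,\tau T$ with $\mathrm{id}_A N\le 1$, one has $\mathrm{pd}_C\,\mathrm{Hom}_A(N,\tau T)\le \mathrm{id}_A N$. 4. For any $N\in\mathrm{Sub}\,\tau T$ with $\mathrm{Ext}^i_A(N\oplus\tau T,\tau T)=0$ for all $i\ge 1$, one has $\mathrm{pd}_C\,\mathrm{Hom}_A(N,\tau T)\le \mathrm{id}_A N$. -/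

import Mathlib

open CategoryTheory

universe u

/-! Right modules over a ring `A` are modules over `Aᵐᵒᵖ`. The notions of the first two sections
are written for left modules over an arbitrary ring `R`; they are used with `R = Aᵐᵒᵖ`. -/

namespace TauTilting

section Modules

variable (R : Type u) [Ring R]

/-- `M` is nonzero and has no nontrivial direct sum decomposition. -/
def IsIndecomposable (M : Type u) [AddCommGroup M] [Module R M] : Prop :=
  Nontrivial M ∧ ∀ N N' : Submodule R M, IsCompl N N' → N = ⊥ ∨ N' = ⊥

/-- The indecomposable direct summands of `M`, as submodules of `M`. -/
def IndecomposableSummand (M : Type u) [AddCommGroup M] [Module R M] : Type u :=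
  {N : Submodule R M // IsIndecomposable R N ∧ ∃ N' : Submodule R M, IsCompl N N'}

/-- Isomorphism of indecomposable direct summands of `M`. -/
def isoSetoid (M : Type u) [AddCommGroup M] [Module R M] : Setoid (IndecomposableSummand R M) where
  r X Y := Nonempty (X.1 ≃ₗ[R] Y.1)
  iseqv :=
    { refl := fun _ => ⟨LinearEquiv.refl R _⟩
      symm := fun ⟨e⟩ => ⟨e.symm⟩
      trans := fun ⟨e⟩ ⟨f⟩ => ⟨e.trans f⟩ }

/-- `|M|`: the number of pairwise nonisomorphic indecomposable direct summands of `M`. -/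
noncomputable def numIndecomposableSummands (M : Type u) [AddCommGroup M] [Module R M] : ℕ∞ :=
  ENat.card (Quotient (isoSetoid R M))

/-- `M ∈ Fac T`: there is an epimorphism `Tⁿ → M` for some `n`. (Finite generation of `M` is
a separate hypothesis.) -/
def MemFac (T M : Type u) [AddCommGroup T] [Module R T] [AddCommGroup M] [Module R M] : Prop :=
  ∃ (n : ℕ) (f : (Fin n → T) →ₗ[R] M), Function.Surjective f

/-- `N ∈ Sub T`: there is a monomorphism `N → Tⁿ` for some `n`. (Finite generation of `N` is
a separate hypothesis.) -/
def MemSub (T N : Type u) [AddCommGroup T] [Module R T] [AddCommGroup N] [Module R N] : Prop :=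
  ∃ (n : ℕ) (f : N →ₗ[R] (Fin n → T)), Function.Injective f

/-- `Extⁱ_R(M, N) = 0` for all `i ≥ 1`. -/
def ExtVanishes (M N : Type u) [AddCommGroup M] [Module R M] [AddCommGroup N] [Module R N] :
    Prop :=
  ∀ i : ℕ, 1 ≤ i → Subsingleton (Abelian.Ext.{u} (ModuleCat.of R M) (ModuleCat.of R N) i)

/-- The projective dimension of a module, in `WithBot ℕ∞` (it is `⊥` exactly for the zero
module). -/
noncomputable def pd (M : Type u) [AddCommGroup M] [Module R M] : WithBot ℕ∞ :=
  projectiveDimension (ModuleCat.of R M)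

/-- The injective dimension of a module, in `WithBot ℕ∞` (it is `⊥` exactly for the zero
module). -/
noncomputable def injd (M : Type u) [AddCommGroup M] [Module R M] : WithBot ℕ∞ :=
  injectiveDimension (ModuleCat.of R M)

/-- `Hom_R(T, M)` as a right module over `B = End_R(T)`, where `f · b = f ∘ b`. -/
@[reducible] def homRightEndModule (T M : Type u) [AddCommGroup T] [Module R T]
    [AddCommGroup M] [Module R M] : Module (Module.End R T)ᵐᵒᵖ (T →ₗ[R] M) where
  smul b f := f ∘ₗ b.unop
  one_smul _ := rfl
  mul_smul _ _ _ := rfl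
  smul_zero _ := rfl
  smul_add _ _ _ := rfl
  add_smul _ _ f := LinearMap.ext fun _ => map_add f _ _
  zero_smul f := LinearMap.ext fun _ => map_zero f

/-- `pd_B Hom_R(T, M)` for the right module `Hom_R(T, M)` over `B = End_R(T)`. -/
noncomputable def pdHomFrom (T M : Type u) [AddCommGroup T] [Module R T]
    [AddCommGroup M] [Module R M] : WithBot ℕ∞ :=
  letI := homRightEndModule R T M
  pd (Module.End R T)ᵐᵒᵖ (T →ₗ[R] M)

/-- `pd_C Hom_R(N, U)` for `C = End_R(U)ᵒᵖ`. A right `C`-module is the same thing as a left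
`End_R(U)`-module; the left action of `End_R(U)` on `Hom_R(N, U)` is `c · f = c ∘ f`. -/
noncomputable def pdHomTo (N U : Type u) [AddCommGroup N] [Module R N]
    [AddCommGroup U] [Module R U] : WithBot ℕ∞ :=
  pd (Module.End R U) (N →ₗ[R] U)

end Modules

section Presentations

/-- A submodule `L` of `P` is superfluous if `N + L = P` implies `N = P`. -/
def IsSuperfluous {R : Type u} [Ring R] {P : Type u} [AddCommGroup P] [Module R P]
    (L : Submodule R P) : Prop :=
  ∀ N : Submodule R P, N ⊔ L = ⊤ → N = ⊤

/-- A minimal projective presentation `P₁ → P₀ → M → 0`, by finitely generated projective modules: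
`P₀ → M` and `P₁ → Ker (P₀ → M)` are projective covers. -/
structure MinimalProjectivePresentation (R : Type u) [Ring R] (M : Type u) [AddCommGroup M]
    [Module R M] where
  P₀ : ModuleCat.{u} R
  P₁ : ModuleCat.{u} R
  finite₀ : Module.Finite R P₀
  finite₁ : Module.Finite R P₁
  projective₀ : Module.Projective R P₀
  projective₁ : Module.Projective R P₁
  d₀ : P₀ →ₗ[R] M
  d₁ : P₁ →ₗ[R] P₀
  surjective : Function.Surjective d₀
  exact : LinearMap.range d₁ = LinearMap.ker d₀
  superfluous₀ : IsSuperfluous (LinearMap.ker d₀)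
  superfluous₁ : IsSuperfluous (LinearMap.ker d₁)

/-- Projective covers of finitely generated modules over an artinian ring exist. -/
theorem exists_projectiveCover (R : Type u) [Ring R] [IsArtinianRing R] (M : Type u)
    [AddCommGroup M] [Module R M] [Module.Finite R M] :
    ∃ (P : ModuleCat.{u} R) (f : P →ₗ[R] M), Module.Finite R P ∧ Module.Projective R P ∧
      Function.Surjective f ∧ IsSuperfluous (LinearMap.ker f) := by
  let S : Set ℕ∞ := {l | ∃ (P : ModuleCat.{u} R) (f : P →ₗ[R] M), Module.Finite R P ∧
    Module.Projective R P ∧ Function.Surjective f ∧ Module.length R P = l}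
  have hS : S.Nonempty := by
    obtain ⟨n, f, hf⟩ := Module.Finite.exists_fin' R M
    exact ⟨_, ModuleCat.of R (Fin n → R), f, inferInstanceAs (Module.Finite R (Fin n → R)),
      inferInstanceAs (Module.Projective R (Fin n → R)), hf, rfl⟩
  obtain ⟨P, f, hfin, hproj, hf, hl⟩ := wellFounded_lt.min_mem S hS
  refine ⟨P, f, hfin, hproj, hf, fun N hN => ?_⟩
  have hfN : Function.Surjective (f ∘ₗ N.subtype) := by
    intro m
    obtain ⟨p, rfl⟩ := hf m
    obtain ⟨n, hn, k, hk, rfl⟩ := Submodule.mem_sup.1 (hN ▸ Submodule.mem_top : p ∈ N ⊔ _)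
    exact ⟨⟨n, hn⟩, by simp [LinearMap.mem_ker.1 hk]⟩
  obtain ⟨g, hg⟩ := Module.projective_lifting_property (f ∘ₗ N.subtype) f hfN
  let e : Module.End R P := N.subtype ∘ₗ g
  have he : ∀ k : ℕ, f ∘ₗ (e ^ k) = f := by
    intro k
    induction k with
    | zero => rfl
    | succ k ih =>
      rw [pow_succ, Module.End.mul_eq_comp, ← LinearMap.comp_assoc, ih]
      exact hg
  obtain ⟨k, hk, hk1⟩ :=
    (e.eventually_isCompl_ker_pow_range_pow.and (Filter.eventually_ge_atTop 1)).exists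
  let Q := LinearMap.range (e ^ k)
  have hQproj : Module.Projective R Q := by
    refine Module.Projective.of_split Q.subtype (Q.projectionOnto _ hk.symm) ?_
    ext x
    simp [Q]
  have hQS : Module.length R Q ∈ S := by
    refine ⟨ModuleCat.of R Q, f ∘ₗ Q.subtype, inferInstanceAs (Module.Finite R Q), hQproj, ?_, rfl⟩
    intro m
    obtain ⟨p, rfl⟩ := hf m
    exact ⟨⟨(e ^ k) p, p, rfl⟩, LinearMap.congr_fun (he k) p⟩
  have hQ : Q = ⊤ := by
    by_contra hne
    exact wellFounded_lt.not_lt_min S hQS (hl ▸ Submodule.length_lt hne)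
  refine top_le_iff.1 (hQ ▸ ?_)
  rintro _ ⟨p, rfl⟩
  obtain ⟨j, rfl⟩ : ∃ j, k = j + 1 := ⟨k - 1, by omega⟩
  rw [pow_succ', Module.End.mul_apply]
  exact (g _).2

/-- Minimal projective presentations of finitely generated modules over an artinian ring exist. -/
theorem nonempty_minimalProjectivePresentation (R : Type u) [Ring R] [IsArtinianRing R]
    (M : Type u) [AddCommGroup M] [Module R M] [Module.Finite R M] :
    Nonempty (MinimalProjectivePresentation R M) := by
  obtain ⟨P₀, d₀, hfin₀, hproj₀, hd₀, hs₀⟩ := exists_projectiveCover R M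
  obtain ⟨P₁, f, hfin₁, hproj₁, hf, hs₁⟩ := exists_projectiveCover R (LinearMap.ker d₀)
  refine ⟨⟨P₀, P₁, hfin₀, hfin₁, hproj₀, hproj₁, d₀, (LinearMap.ker d₀).subtype ∘ₗ f, hd₀, ?_,
    hs₀, ?_⟩⟩
  · rw [LinearMap.range_comp, LinearMap.range_eq_top.2 hf, Submodule.map_top,
      Submodule.range_subtype]
  · rwa [LinearMap.ker_comp, Submodule.ker_subtype, Submodule.comap_bot]

end Presentations

section Translate

variable (K : Type u) [Field K] (A : Type u) [Ring A] [Algebra K A]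

/-- The standard duality `D X = Hom_K(X, K)`. -/
def KDual (X : Type u) [AddCommGroup X] [Module K X] : Type u := X →ₗ[K] K

instance (X : Type u) [AddCommGroup X] [Module K X] : AddCommGroup (KDual K X) :=
  inferInstanceAs (AddCommGroup (X →ₗ[K] K))

/-- If `X` is a left `A`-module, then `D X` is a right `A`-module: `(φ · a) x = φ (a x)`. -/
instance (X : Type u) [AddCommGroup X] [Module K X] [Module A X] [IsScalarTower K A X] :
    Module Aᵐᵒᵖ (KDual K X) where
  smul a φ := LinearMap.comp φ (Algebra.lsmul K K X a.unop)
  one_smul φ := LinearMap.ext fun x => congrArg φ.toFun (one_smul A x)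
  mul_smul a b φ := LinearMap.ext fun x => congrArg φ.toFun (mul_smul b.unop a.unop x)
  smul_zero _ := rfl
  smul_add _ _ _ := rfl
  add_smul a b φ := LinearMap.ext fun x =>
    (congrArg φ.toFun (add_smul a.unop b.unop x)).trans (LinearMap.map_add φ _ _)
  zero_smul φ := LinearMap.ext fun x =>
    (congrArg φ.toFun (zero_smul A x)).trans (LinearMap.map_zero φ)

variable {A} {M : Type u} [AddCommGroup M] [Module Aᵐᵒᵖ M]

/-- The transpose `Tr M = Coker (Hom_A(P₀, A) → Hom_A(P₁, A))` computed from a minimal projective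
presentation of the right module `M`; the left action of `A` on `Hom_A(P, A)` is
`(a · h) x = a (h x)`. -/
abbrev MinimalProjectivePresentation.Transpose (P : MinimalProjectivePresentation Aᵐᵒᵖ M) :
    Type u :=
  (P.P₁ →ₗ[Aᵐᵒᵖ] A) ⧸ LinearMap.range (LinearMap.lcomp A A P.d₁)

/-- `D Tr M` computed from a minimal projective presentation of the right module `M`. -/
abbrev MinimalProjectivePresentation.DTr (P : MinimalProjectivePresentation Aᵐᵒᵖ M) : Type u :=
  KDual K P.Transpose

variable (A)

theorem isArtinianRing_op [Module.Finite K A] : IsArtinianRing Aᵐᵒᵖ :=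
  haveI : Module.Finite K Aᵐᵒᵖ := Module.Finite.equiv (MulOpposite.opLinearEquiv K : A ≃ₗ[K] Aᵐᵒᵖ)
  IsArtinianRing.of_finite K Aᵐᵒᵖ

variable [Module.Finite K A] (T : Type u) [AddCommGroup T] [Module Aᵐᵒᵖ T] [Module.Finite Aᵐᵒᵖ T]

/-- A choice of minimal projective presentation (it is unique up to isomorphism). -/
noncomputable def minimalPresentation : MinimalProjectivePresentation Aᵐᵒᵖ T :=
  haveI := isArtinianRing_op K A
  (nonempty_minimalProjectivePresentation Aᵐᵒᵖ T).some

/-- The Auslander-Reiten translate `τ T = D Tr T` of a finitely generated right module `T` over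
the finite dimensional `K`-algebra `A`. -/
noncomputable def arTranslate : ModuleCat.{u} Aᵐᵒᵖ :=
  ModuleCat.of Aᵐᵒᵖ ((minimalPresentation K A T).DTr K)

/-- `T` is `τ`-rigid if `Hom_A(T, τ T) = 0`. -/
def IsTauRigid : Prop :=
  ∀ f : T →ₗ[Aᵐᵒᵖ] arTranslate K A T, f = 0

/-- `T` is `τ`-tilting if it is `τ`-rigid and `|T| = |A|`, where `A` is regarded as a right module
over itself. -/
def IsTauTilting : Prop :=
  IsTauRigid K A T ∧ numIndecomposableSummands Aᵐᵒᵖ T = numIndecomposableSummands Aᵐᵒᵖ A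

end Translate

end TauTilting

/-!
Fix a minimal projective presentation `P₁ → P₀ → T → 0`. A right `A`-module `X` satisfies
`Hom(X, τT) = D Coker (Hom(P₀, X) → Hom(P₁, X))`, so `Hom(X, τT) = 0` means that every homomorphism
`P₁ → X` extends along `P₁ → P₀` (`ExtendsAlong`, `forall_hom_DTr_eq_zero_iff`). This condition
passes to quotients and powers, and it gives `Ext¹(T, X) = 0`. The same duality, in the form
`forall_exists_comp_eq_DTr_iff`, gives `Ext¹(Y, τT) = 0` for all `Y` with `Hom(T, Y) = 0`.

The condition `|T| = |A|` enters through `IsTauTilting.memFac`: every finitely generated `X` with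
`Hom(X, τT) = 0` lies in `Fac T`. Such an `X` is generated by the Bongartz complement `V`, an
explicit pushout, and `V ⊕ T` inherits the extension property along an explicit presentation. Hence
`|V ⊕ T| ≤ |A|` (`numIndecomposableSummands_le`): the pairings `dim Hom(P₀, M) - dim Hom(P₁, M)`
with the presentations of the indecomposable summands are additive in `M`, so the vectors they form
are spanned by those of the simple modules, and there are at most `|A|` of the latter; on the other
hand their span contains each unit vector. So `V ⊕ T` has no indecomposable summands besides
those of `T`, and `V ∈ Fac T`.

Consequently a module in `Fac T` has a right `add T`-approximation that is onto and has its kernel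
in `Fac T`. Dually, a module `N` with `Hom(T, N) = 0` embeds into a power of `τT` by a left
approximation whose cokernel `L` satisfies `Hom(T, L) = 0`.

Iterating the approximations resolves `M` by powers of `T`, with all syzygies in a class `W` such
that `Extⁱ(T, W) = 0` in the degrees needed: `W = Fac T` if `pd M ≤ 1`, and its subclass of modules
`X` with `Extⁱ(T, X) = 0` for all `i ≥ 1` in the other case. If `pd M = n`, dimension shifting shows
that the last epimorphism onto the `n`-th syzygy splits. The approximation property makes
`Hom(T, -)` exact on the resolution, so it becomes a projective resolution of `Hom(T, M)` of length
`n` (`hasProjectiveDimensionLT_homFrom`). The statements on `Sub τT` are obtained in the same way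
with `hasProjectiveDimensionLT_homTo`.
-/

namespace TauTilting

/-! ### Extensions along a projective presentation -/

section Extension

variable {R : Type u} [Ring R]

/-- Every homomorphism `P₁ → X` extends along `d : P₁ → P₀`. For a projective presentation
`P₁ → P₀ → T → 0` with first map `d`, this says that `Hom_R(P₀, X) → Hom_R(P₁, X)` is onto; for a
minimal presentation it is equivalent to `Hom_R(X, τ T) = 0`. -/
def ExtendsAlong {P₁ P₀ : Type u} [AddCommGroup P₁] [Module R P₁] [AddCommGroup P₀] [Module R P₀]
    (d : P₁ →ₗ[R] P₀) (X : Type u) [AddCommGroup X] [Module R X] : Prop :=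
  ∀ g : P₁ →ₗ[R] X, ∃ h : P₀ →ₗ[R] X, h ∘ₗ d = g

variable {P₁ P₀ T E F X Y : Type u} [AddCommGroup P₁] [Module R P₁] [AddCommGroup P₀] [Module R P₀]
  [AddCommGroup T] [Module R T] [AddCommGroup E] [Module R E]
  [AddCommGroup F] [Module R F] [AddCommGroup X] [Module R X] [AddCommGroup Y] [Module R Y]
  {d : P₁ →ₗ[R] P₀} {d₀ : P₀ →ₗ[R] T}

theorem exists_comp_eq_of_ker_le (hd₀ : Function.Surjective d₀) (k : P₀ →ₗ[R] E)
    (hk : LinearMap.ker d₀ ≤ LinearMap.ker k) : ∃ f : T →ₗ[R] E, f ∘ₗ d₀ = k := by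
  refine ⟨(LinearMap.ker d₀).liftQ k hk ∘ₗ (d₀.quotKerEquivOfSurjective hd₀).symm, ?_⟩
  ext x
  have : (d₀.quotKerEquivOfSurjective hd₀).symm (d₀ x) = (LinearMap.ker d₀).mkQ x := by
    rw [LinearEquiv.symm_apply_eq]; rfl
  simp [this]

/-- Homomorphisms from a module `T` with presentation `d` lift along an epimorphism whose kernel
admits extensions along `d`; in effect `Ext¹(T, K) = 0` for such a kernel `K`. -/
theorem exists_lift_of_extendsAlong [Module.Projective R P₀] (hd₀ : Function.Surjective d₀)
    (hex : LinearMap.range d = LinearMap.ker d₀) (p : E →ₗ[R] F) (hp : Function.Surjective p)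
    (hK : ExtendsAlong d (LinearMap.ker p)) (f : T →ₗ[R] F) : ∃ f' : T →ₗ[R] E, p ∘ₗ f' = f := by
  obtain ⟨k, hk⟩ := Module.projective_lifting_property p (f ∘ₗ d₀) hp
  have hdd (x : P₁) : d₀ (d x) = 0 := by
    rw [← LinearMap.mem_ker, ← hex]; exact ⟨x, rfl⟩
  obtain ⟨h, hh⟩ := hK ((k ∘ₗ d).codRestrict (LinearMap.ker p) fun x => by
    simpa [hdd] using LinearMap.congr_fun hk (d x))
  obtain ⟨f', hf'⟩ := exists_comp_eq_of_ker_le hd₀ (k - (LinearMap.ker p).subtype ∘ₗ h) (by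
    rw [← hex]
    rintro _ ⟨x, rfl⟩
    have := congrArg Subtype.val (LinearMap.congr_fun hh x)
    simp at this
    simp [this])
  refine ⟨f', ?_⟩
  rw [← LinearMap.cancel_right hd₀, LinearMap.comp_assoc, hf', ← hk]
  ext x
  simp

theorem ExtendsAlong.of_surjective [Module.Projective R P₁] (hX : ExtendsAlong d X)
    (q : X →ₗ[R] Y) (hq : Function.Surjective q) : ExtendsAlong d Y := by
  intro g
  obtain ⟨g', hg'⟩ := Module.projective_lifting_property q g hq
  obtain ⟨h, hh⟩ := hX g'
  exact ⟨q ∘ₗ h, by rw [LinearMap.comp_assoc, hh, hg']⟩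

theorem ExtendsAlong.pi {ι : Type} (hX : ExtendsAlong d X) : ExtendsAlong d (ι → X) := by
  intro g
  choose h hh using fun i => hX (LinearMap.proj i ∘ₗ g)
  refine ⟨LinearMap.pi h, ?_⟩
  ext x i
  exact LinearMap.congr_fun (hh i) x

theorem ExtendsAlong.prod (hX : ExtendsAlong d X) (hY : ExtendsAlong d Y) :
    ExtendsAlong d (X × Y) := by
  intro g
  obtain ⟨h, hh⟩ := hX (LinearMap.fst R X Y ∘ₗ g)
  obtain ⟨h', hh'⟩ := hY (LinearMap.snd R X Y ∘ₗ g)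
  refine ⟨h.prod h', ?_⟩
  ext x
  · exact LinearMap.congr_fun hh x
  · exact LinearMap.congr_fun hh' x

theorem ExtendsAlong.of_memFac [Module.Projective R P₁] (hT : ExtendsAlong d T)
    (hX : MemFac R T X) : ExtendsAlong d X := by
  obtain ⟨n, f, hf⟩ := hX
  exact hT.pi.of_surjective f hf

theorem ExtendsAlong.of_linearEquiv (hX : ExtendsAlong d X) (e : X ≃ₗ[R] Y) :
    ExtendsAlong d Y := by
  intro g
  obtain ⟨h, hh⟩ := hX (e.symm.toLinearMap ∘ₗ g)
  refine ⟨e.toLinearMap ∘ₗ h, ?_⟩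
  ext x
  simpa using congrArg e (LinearMap.congr_fun hh x)

/-- The kernel of a right approximation `p : E → M` by a module with extensions along `d` again
has extensions along `d`. -/
theorem ExtendsAlong.ker [Module.Projective R P₀] (hd₀ : Function.Surjective d₀)
    (hex : LinearMap.range d = LinearMap.ker d₀) (p : E →ₗ[R] F)
    (hE : ExtendsAlong d E) (happ : ∀ f : T →ₗ[R] F, ∃ f' : T →ₗ[R] E, p ∘ₗ f' = f) :
    ExtendsAlong d (LinearMap.ker p) := by
  intro g
  obtain ⟨h, hh⟩ := hE ((LinearMap.ker p).subtype ∘ₗ g)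
  have hdd (x : P₁) : d₀ (d x) = 0 := by
    rw [← LinearMap.mem_ker, ← hex]; exact ⟨x, rfl⟩
  have hh' (x : P₁) : h (d x) = g x := LinearMap.congr_fun hh x
  obtain ⟨f, hf⟩ := exists_comp_eq_of_ker_le hd₀ (p ∘ₗ h) (by
    rw [← hex]
    rintro _ ⟨x, rfl⟩
    simp [hh'])
  obtain ⟨f', hf'⟩ := happ f
  refine ⟨(h - f' ∘ₗ d₀).codRestrict _ fun x => ?_, ?_⟩
  · have h1 := LinearMap.congr_fun hf x
    have h2 := LinearMap.congr_fun hf' (d₀ x)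
    simp at h1 h2
    simp [h1, h2]
  · ext x
    simp [hdd, hh']

theorem surjective_of_isSuperfluous (hs : IsSuperfluous (LinearMap.ker d₀)) (e : E →ₗ[R] P₀)
    (he : Function.Surjective (d₀ ∘ₗ e)) : Function.Surjective e := by
  rw [← LinearMap.range_eq_top]
  refine hs _ (eq_top_iff.2 fun x _ => ?_)
  obtain ⟨y, hy⟩ := he (d₀ x)
  have : x = e y + (x - e y) := by abel
  rw [this]
  refine Submodule.add_mem_sup ⟨y, rfl⟩ ?_
  simp at hy
  simp [hy]

/-- If `X` is a direct summand of `Y`, extensions along a presentation of `Y` yield extensions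
along a minimal presentation of `X`, because the latter is a direct summand of the former. -/
theorem ExtendsAlong.of_retract [IsArtinianRing R] {E₁ E₀ Z : Type u}
    [AddCommGroup E₁] [Module R E₁] [AddCommGroup E₀] [Module R E₀] [AddCommGroup Z] [Module R Z]
    {d' : E₁ →ₗ[R] E₀} {d₀' : E₀ →ₗ[R] Y}
    [Module.Projective R E₁] [Module.Projective R E₀]
    (hd₀' : Function.Surjective d₀') (hex' : LinearMap.range d' = LinearMap.ker d₀')
    (P : MinimalProjectivePresentation R X) (i : X →ₗ[R] Y) (r : Y →ₗ[R] X)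
    (hri : r ∘ₗ i = LinearMap.id) (hZ : ExtendsAlong d' Z) : ExtendsAlong P.d₁ Z := by
  have := P.finite₀
  have := P.finite₁
  have := P.projective₀
  have := P.projective₁
  have hPd (x) : P.d₀ (P.d₁ x) = 0 := by
    rw [← LinearMap.mem_ker, ← P.exact]; exact ⟨x, rfl⟩
  have hEd (x) : d₀' (d' x) = 0 := by
    rw [← LinearMap.mem_ker, ← hex']; exact ⟨x, rfl⟩
  obtain ⟨a₀, ha₀⟩ := Module.projective_lifting_property d₀' (i ∘ₗ P.d₀) hd₀'
  obtain ⟨b₀, hb₀⟩ := Module.projective_lifting_property P.d₀ (r ∘ₗ d₀') P.surjective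
  have ha₀' (x) : d₀' (a₀ x) = i (P.d₀ x) := LinearMap.congr_fun ha₀ x
  have hb₀' (x) : P.d₀ (b₀ x) = r (d₀' x) := LinearMap.congr_fun hb₀ x
  have hri' (x) : r (i x) = x := LinearMap.congr_fun hri x
  obtain ⟨a₁, ha₁⟩ := Module.projective_lifting_property d'.rangeRestrict
    ((a₀ ∘ₗ P.d₁).codRestrict (LinearMap.range d') fun x => by
      rw [hex']; simp [ha₀', hPd]) d'.surjective_rangeRestrict
  obtain ⟨b₁, hb₁⟩ := Module.projective_lifting_property P.d₁.rangeRestrict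
    ((b₀ ∘ₗ d').codRestrict (LinearMap.range P.d₁) fun x => by
      rw [P.exact]; simp [hb₀', hEd]) P.d₁.surjective_rangeRestrict
  have ha₁' (x) : d' (a₁ x) = a₀ (P.d₁ x) := congrArg Subtype.val (LinearMap.congr_fun ha₁ x)
  have hb₁' (x) : P.d₁ (b₁ x) = b₀ (d' x) := congrArg Subtype.val (LinearMap.congr_fun hb₁ x)
  have hs₀ : Function.Surjective (b₀ ∘ₗ a₀) := by
    refine surjective_of_isSuperfluous P.superfluous₀ _ ?_
    convert P.surjective using 1
    ext x
    simp [hb₀', ha₀', hri']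
  have hi₀ : Function.Injective (b₀ ∘ₗ a₀) :=
    IsNoetherian.injective_of_surjective_endomorphism _ hs₀
  let e₀ := LinearEquiv.ofBijective _ ⟨hi₀, hs₀⟩
  have hs₁ : Function.Surjective (b₁ ∘ₗ a₁) := by
    have hsub : Function.Surjective (P.d₁.rangeRestrict ∘ₗ (b₁ ∘ₗ a₁)) := by
      -- `b₀ a₀` maps `range d₁` bijectively to itself, being injective on an artinian module
      let c : LinearMap.range P.d₁ →ₗ[R] LinearMap.range P.d₁ :=
        (b₀ ∘ₗ a₀).restrict (by
          rintro _ ⟨x, rfl⟩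
          exact ⟨b₁ (a₁ x), by simp [hb₁', ha₁']⟩)
      have hc : Function.Surjective c := IsArtinian.surjective_of_injective_endomorphism c
        fun x y hxy => Subtype.ext (hi₀ (congrArg Subtype.val hxy))
      rintro y
      obtain ⟨⟨_, x, rfl⟩, rfl⟩ := hc y
      exact ⟨x, Subtype.ext (by simp [c, hb₁', ha₁'])⟩
    refine surjective_of_isSuperfluous (d₀ := P.d₁.rangeRestrict) ?_ _ hsub
    rw [LinearMap.ker_rangeRestrict]
    exact P.superfluous₁
  have hi₁ : Function.Injective (b₁ ∘ₗ a₁) :=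
    IsNoetherian.injective_of_surjective_endomorphism _ hs₁
  let e₁ := LinearEquiv.ofBijective _ ⟨hi₁, hs₁⟩
  intro g
  obtain ⟨h, hh⟩ := hZ ((g ∘ₗ e₁.symm.toLinearMap) ∘ₗ b₁)
  have hh' (x) : h (d' x) = g (e₁.symm (b₁ x)) := LinearMap.congr_fun hh x
  refine ⟨h ∘ₗ a₀, ?_⟩
  ext x
  have : b₁ (a₁ x) = e₁ x := rfl
  simp [← ha₁', hh', this]

end Extension

/-! ### The Bongartz complement -/

section Bongartz

variable {R : Type u} [Ring R]
variable {P₁ P₀ T X : Type u} [AddCommGroup P₁] [Module R P₁] [AddCommGroup P₀] [Module R P₀]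
  [AddCommGroup T] [Module R T] [AddCommGroup X] [Module R X]

/-- The first map `P₁ʳ → R ⊕ P₀ʳ` in the presentation of the Bongartz complement attached to
homomorphisms `f₁, …, fᵣ : P₁ → R`; its components are the `fᵢ` and copies of `-d`. -/
noncomputable def bongartzMap {r : ℕ} (d : P₁ →ₗ[R] P₀) (f : Fin r → P₁ →ₗ[R] R) :
    (Fin r → P₁) →ₗ[R] R × (Fin r → P₀) :=
  (∑ i, f i ∘ₗ LinearMap.proj i).prod (-LinearMap.pi fun i => d ∘ₗ LinearMap.proj i)

/-- The Bongartz complement of a module with presentation `d`, as the cokernel of `bongartzMap`: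
the pushout of `P₁ʳ → R` and `P₁ʳ → P₀ʳ`. -/
abbrev BongartzComplement {r : ℕ} (d : P₁ →ₗ[R] P₀) (f : Fin r → P₁ →ₗ[R] R) : Type u :=
  (R × (Fin r → P₀)) ⧸ LinearMap.range (bongartzMap d f)

variable {r : ℕ} {d : P₁ →ₗ[R] P₀} {d₀ : P₀ →ₗ[R] T} (f : Fin r → P₁ →ₗ[R] R)

theorem bongartzMap_apply (p : Fin r → P₁) :
    bongartzMap d f p = (∑ i, f i (p i), fun i => -d (p i)) := by
  ext i <;> simp [bongartzMap]

/-- The Bongartz complement generates every finitely generated module `X` that has extensions along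
`d`: each homomorphism `R → X` factors through the canonical map from `R` to the complement. -/
theorem ExtendsAlong.memFac_bongartzComplement [Module.Finite R X] (hX : ExtendsAlong d X) :
    MemFac R (BongartzComplement d f) X := by
  have key (a : R →ₗ[R] X) : ∃ v : BongartzComplement d f →ₗ[R] X,
      ∀ s, v (Submodule.Quotient.mk (s, 0)) = a s := by
    choose h hh using fun i => hX (a ∘ₗ f i)
    have hh' (i x) : h i (d x) = a (f i x) := LinearMap.congr_fun (hh i) x
    refine ⟨(LinearMap.range (bongartzMap d f)).liftQ
      (a.coprod (∑ i, h i ∘ₗ LinearMap.proj i)) ?_, fun s => ?_⟩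
    · rintro _ ⟨p, rfl⟩
      simp [bongartzMap_apply, hh']
    · simp
  obtain ⟨n, g, hg⟩ := Module.Finite.exists_fin' R X
  choose v hv using fun i : Fin n => key (g ∘ₗ LinearMap.single R (fun _ => R) i)
  refine ⟨n, ∑ i, v i ∘ₗ LinearMap.proj i, fun x => ?_⟩
  obtain ⟨y, rfl⟩ := hg x
  refine ⟨fun i => Submodule.Quotient.mk (y i, 0), ?_⟩
  simp [hv, ← map_sum, LinearMap.sum_single_apply]

/-- Extensions along `d` yield extensions along the presentation of the Bongartz completion: the
component `P₁ʳ → P₀ʳ` of `bongartzMap d f` alone suffices. -/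
theorem ExtendsAlong.bongartzMap_prodMap (hX : ExtendsAlong d X) :
    ExtendsAlong ((bongartzMap d f).prodMap d) X := by
  intro g
  choose h hh using fun i => hX (g ∘ₗ LinearMap.inl R _ _ ∘ₗ LinearMap.single R (fun _ => P₁) i)
  obtain ⟨h', hh'⟩ := hX (g ∘ₗ LinearMap.inr R _ _)
  have e (i x) : h i (d x) = g (Pi.single i x, 0) := LinearMap.congr_fun (hh i) x
  have e' (x) : h' (d x) = g (0, x) := LinearMap.congr_fun hh' x
  refine ⟨((-∑ i, h i ∘ₗ LinearMap.proj i) ∘ₗ LinearMap.snd R R _).coprod h', ?_⟩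
  ext x
  · simp [bongartzMap_apply, Pi.single_apply, apply_ite, e]
  · simp [e']

/-- If the `fᵢ` span `Hom_R(P₁, R)`, the Bongartz complement has extensions along `d`. -/
theorem ExtendsAlong.bongartzComplement (K : Type u) [Field K] [Algebra K R]
    [Module.Projective R P₁] [Module.Projective R P₀] (hd₀ : Function.Surjective d₀)
    (hex : LinearMap.range d = LinearMap.ker d₀) (hT : ExtendsAlong d T)
    (hf : Submodule.span K (Set.range f) = ⊤) :
    ExtendsAlong d (BongartzComplement d f) := by
  let _ : Module K P₀ := Module.compHom P₀ (algebraMap K R)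
  have : IsScalarTower K R P₀ := .of_algebraMap_smul fun _ _ => rfl
  have hdd (x) : d₀ (d x) = 0 := by
    rw [← LinearMap.mem_ker, ← hex]; exact ⟨x, rfl⟩
  let ι : R →ₗ[R] BongartzComplement d f :=
    (LinearMap.range (bongartzMap d f)).mkQ ∘ₗ LinearMap.inl R R (Fin r → P₀)
  -- homomorphisms factoring through `R` extend, by the pushout relations
  have hι (u : P₁ →ₗ[R] R) : ∃ h : P₀ →ₗ[R] BongartzComplement d f, h ∘ₗ d = ι ∘ₗ u := by
    have hu : u ∈ Submodule.span K (Set.range f) := hf ▸ Submodule.mem_top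
    induction hu using Submodule.span_induction with
    | mem u hu =>
      obtain ⟨i, rfl⟩ := hu
      refine ⟨(LinearMap.range (bongartzMap d f)).mkQ ∘ₗ LinearMap.inr R R (Fin r → P₀) ∘ₗ
        LinearMap.single R (fun _ => P₀) i, ?_⟩
      ext x
      simp only [LinearMap.comp_apply, Submodule.mkQ_apply, ι]
      refine ((Submodule.Quotient.eq (LinearMap.range (bongartzMap d f))).2
        ⟨Pi.single i x, ?_⟩).symm
      rw [bongartzMap_apply]
      ext j
      · simp [Pi.single_apply, apply_ite]
      · by_cases hj : j = i
        · subst hj; simp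
        · simp [hj]
    | zero => exact ⟨0, by simp⟩
    | add u v _ _ hu hv =>
      obtain ⟨h, hh⟩ := hu
      obtain ⟨h', hh'⟩ := hv
      exact ⟨h + h', by rw [LinearMap.add_comp, hh, hh', LinearMap.comp_add]⟩
    | smul c u _ hu =>
      obtain ⟨h, hh⟩ := hu
      refine ⟨c • h, ?_⟩
      ext x
      have := LinearMap.congr_fun hh x
      simp only [LinearMap.comp_apply] at this
      simp [this, LinearMap.map_smul_of_tower]
  let q : BongartzComplement d f →ₗ[R] (Fin r → T) :=
    (LinearMap.range (bongartzMap d f)).liftQ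
      ((LinearMap.pi fun i => d₀ ∘ₗ LinearMap.proj i) ∘ₗ LinearMap.snd R R (Fin r → P₀)) (by
        rintro _ ⟨p, rfl⟩
        rw [bongartzMap_apply]
        ext i
        simp [hdd])
  have hq : Function.Surjective q := by
    intro t
    choose y hy using fun i => hd₀ (t i)
    exact ⟨Submodule.Quotient.mk (0, y), funext hy⟩
  have hker (x : BongartzComplement d f) (hx : q x = 0) : ∃ s, ι s = x := by
    obtain ⟨⟨s, y⟩, rfl⟩ := Submodule.Quotient.mk_surjective _ x
    have hy (i) : ∃ p, d p = y i := by
      change y i ∈ LinearMap.range d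
      rw [hex]
      exact congrFun hx i
    choose p hp using hy
    refine ⟨s + ∑ i, f i (p i),
      (Submodule.Quotient.eq (LinearMap.range (bongartzMap d f))).2 ⟨p, ?_⟩⟩
    rw [bongartzMap_apply]
    ext i <;> simp [hp]
  intro g
  obtain ⟨h₁, hh₁⟩ := hT.pi (q ∘ₗ g)
  obtain ⟨h, hh⟩ := Module.projective_lifting_property q h₁ hq
  have hh' (x) : q (h (d x)) = q (g x) :=
    (LinearMap.congr_fun hh (d x)).trans (LinearMap.congr_fun hh₁ x)
  obtain ⟨u, hu⟩ := Module.projective_lifting_property ι.rangeRestrict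
    ((g - h ∘ₗ d).codRestrict (LinearMap.range ι) fun x => hker _ (by simp [hh']))
    ι.surjective_rangeRestrict
  obtain ⟨h', hh''⟩ := hι u
  refine ⟨h + h', ?_⟩
  ext x
  have h1 : ι (u x) = g x - h (d x) := congrArg Subtype.val (LinearMap.congr_fun hu x)
  have h2 : h' (d x) = ι (u x) := LinearMap.congr_fun hh'' x
  simp [h1, h2]

end Bongartz

/-! ### Finite dimensional spaces of homomorphisms -/

section FiniteDimension

variable (K : Type u) [Field K] {R : Type u} [Ring R] [Algebra K R]

theorem finite_hom (M N : Type u) [AddCommGroup M] [Module R M] [Module.Finite R M]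
    [AddCommGroup N] [Module R N] [Module K N] [IsScalarTower K R N] [Module.Finite K N] :
    Module.Finite K (M →ₗ[R] N) := by
  obtain ⟨n, g, hg⟩ := Module.Finite.exists_fin' R M
  let ev : (M →ₗ[R] N) →ₗ[K] (Fin n → N) :=
    { toFun := fun f i => f (g (Pi.single i 1))
      map_add' := fun _ _ => rfl
      map_smul' := fun _ _ => rfl }
  refine Module.Finite.of_injective ev fun f f' hff => ?_
  rw [← LinearMap.cancel_right hg]
  refine LinearMap.pi_ext' fun i => LinearMap.ext_ring ?_
  exact congrFun hff i

end FiniteDimension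

/-! ### Homomorphisms to the Auslander–Reiten translate -/

section Duality

open MulOpposite

variable (A : Type u) [Ring A]

/-- `A`, as a right module over itself, is free of rank one. -/
def unopLinearEquiv : Aᵐᵒᵖ ≃ₗ[Aᵐᵒᵖ] A where
  toFun := MulOpposite.unop
  map_add' _ _ := rfl
  map_smul' _ _ := rfl
  invFun := MulOpposite.op
  left_inv _ := rfl
  right_inv _ := rfl

variable {A}

/-- A dual basis of a finitely generated projective right `A`-module `Q`, with functionals `Q → A`. -/
theorem exists_dualBasis (Q : Type u) [AddCommGroup Q] [Module Aᵐᵒᵖ Q] [Module.Finite Aᵐᵒᵖ Q]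
    [Module.Projective Aᵐᵒᵖ Q] : ∃ (n : ℕ) (e : Fin n → Q) (c : Fin n → Q →ₗ[Aᵐᵒᵖ] A),
      ∀ q, ∑ j, op (c j q) • e j = q := by
  obtain ⟨n, g, s, -, -, hgs⟩ := Module.Finite.exists_comp_eq_id_of_projective Aᵐᵒᵖ Q
  refine ⟨n, fun j => g (Pi.single j 1),
    fun j => (unopLinearEquiv A).toLinearMap ∘ₗ LinearMap.proj j ∘ₗ s, fun q => ?_⟩
  have h1 : ∑ j, s q j • (Pi.single j 1 : Fin n → Aᵐᵒᵖ) = s q := by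
    ext i
    simp [Pi.single_apply]
  have h2 := congrArg g h1
  rw [map_sum] at h2
  simp only [map_smul] at h2
  exact h2.trans (LinearMap.congr_fun hgs q)

variable {Q X Y : Type u} [AddCommGroup Q] [Module Aᵐᵒᵖ Q] [AddCommGroup X] [Module Aᵐᵒᵖ X]
  [AddCommGroup Y] [Module Aᵐᵒᵖ Y]

/-- The image of `x ⊗ h` under the canonical map `X ⊗ Hom_A(Q, A) → Hom_A(Q, X)`:
the homomorphism `q ↦ x · h q`. -/
def tensorHom (x : X) (h : Q →ₗ[Aᵐᵒᵖ] A) : Q →ₗ[Aᵐᵒᵖ] X where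
  toFun q := op (h q) • x
  map_add' q q' := by simp [add_smul]
  map_smul' a q := by
    rw [map_smul, RingHom.id_apply, ← mul_smul]
    rfl

@[simp]
theorem tensorHom_apply (x : X) (h : Q →ₗ[Aᵐᵒᵖ] A) (q : Q) : tensorHom x h q = op (h q) • x := rfl

theorem sum_tensorHom {n : ℕ} {e : Fin n → Q} {c : Fin n → Q →ₗ[Aᵐᵒᵖ] A}
    (hec : ∀ q, ∑ j, op (c j q) • e j = q) (v : Q →ₗ[Aᵐᵒᵖ] X) :
    ∑ j, tensorHom (v (e j)) (c j) = v := by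
  ext q
  conv_rhs => rw [← hec q]
  simp

theorem sum_smul_dualBasis {n : ℕ} {e : Fin n → Q} {c : Fin n → Q →ₗ[Aᵐᵒᵖ] A}
    (hec : ∀ q, ∑ j, op (c j q) • e j = q) (h : Q →ₗ[Aᵐᵒᵖ] A) :
    ∑ j, h (e j) • c j = h := by
  ext q
  conv_rhs => rw [← hec q]
  simp

variable {K : Type u} [Field K] [Algebra K A] {T : Type u} [AddCommGroup T] [Module Aᵐᵒᵖ T]
  (P : MinimalProjectivePresentation Aᵐᵒᵖ T)
  [Module K X] [IsScalarTower K Aᵐᵒᵖ X] [Module K Y] [IsScalarTower K Aᵐᵒᵖ Y]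

/-- An element of `D Tr T` as the functional on `Tr T` that it is. -/
def DTrFunctional (t : P.DTr K) : P.Transpose →ₗ[K] K := t

theorem functional_ext {lam lam' : (P.P₁ →ₗ[Aᵐᵒᵖ] X) →ₗ[K] K}
    (h : ∀ x v, lam (tensorHom x v) = lam' (tensorHom x v)) : lam = lam' := by
  have := P.finite₁
  have := P.projective₁
  obtain ⟨n, e, c, hec⟩ := exists_dualBasis (A := A) P.P₁
  ext v
  rw [← sum_tensorHom hec v, map_sum, map_sum]
  exact Finset.sum_congr rfl fun j _ => h _ _

/-- A `K`-functional on `Hom_A(P₁, X)` that kills the image of `Hom_A(P₀, X)` defines a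
homomorphism `X → D Tr T`. -/
theorem exists_hom_of_functional (lam : (P.P₁ →ₗ[Aᵐᵒᵖ] X) →ₗ[K] K)
    (hlam : ∀ k : P.P₀ →ₗ[Aᵐᵒᵖ] X, lam (k ∘ₗ P.d₁) = 0) :
    ∃ φ : X →ₗ[Aᵐᵒᵖ] P.DTr K, ∀ x v, DTrFunctional P (φ x) (Submodule.Quotient.mk v) =
      lam (tensorHom x v) := by
  let N : Submodule A (P.P₁ →ₗ[Aᵐᵒᵖ] A) := LinearMap.range (LinearMap.lcomp A A P.d₁)
  let ev (x : X) : (P.P₁ →ₗ[Aᵐᵒᵖ] A) →ₗ[K] K :=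
    { toFun := fun v => lam (tensorHom x v)
      map_add' := fun v w => by
        rw [← map_add]; congr 1; ext p; simp [add_smul]
      map_smul' := fun c v => by
        rw [RingHom.id_apply, ← map_smul]; congr 1; ext p; simp }
  let F (x : X) : P.Transpose →ₗ[K] K :=
    (N.restrictScalars K).liftQ (ev x) (by
      rintro _ ⟨k, rfl⟩
      refine Eq.trans (congrArg lam ?_) (hlam (tensorHom x k))
      ext p
      rfl) ∘ₗ (Submodule.Quotient.restrictScalarsEquiv K N).symm.toLinearMap
  have hF (x v) : F x (Submodule.Quotient.mk v) = lam (tensorHom x v) := rfl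
  refine ⟨{ toFun := F, map_add' := fun x y => ?_, map_smul' := fun a x => ?_ }, hF⟩
  · refine LinearMap.ext fun t => ?_
    obtain ⟨v, rfl⟩ := Submodule.Quotient.mk_surjective _ t
    change F (x + y) _ = F x _ + F y _
    rw [hF, hF, hF, ← map_add]
    congr 1; ext p; simp
  · refine LinearMap.ext fun t => ?_
    obtain ⟨v, rfl⟩ := Submodule.Quotient.mk_surjective _ t
    change F (a • x) _ = F x (a.unop • Submodule.Quotient.mk v)
    rw [← Submodule.Quotient.mk_smul, hF, hF]
    congr 1; ext p; simp [← mul_smul]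

/-- Every homomorphism `X → D Tr T` comes from a `K`-functional on `Hom_A(P₁, X)` that kills the
image of `Hom_A(P₀, X)`. Together with `exists_hom_of_functional` this is the isomorphism
`Hom_A(X, D Tr T) ≅ D (Coker (Hom_A(P₀, X) → Hom_A(P₁, X)))`. -/
theorem exists_functional_of_hom (φ : X →ₗ[Aᵐᵒᵖ] P.DTr K) :
    ∃ lam : (P.P₁ →ₗ[Aᵐᵒᵖ] X) →ₗ[K] K, (∀ k : P.P₀ →ₗ[Aᵐᵒᵖ] X, lam (k ∘ₗ P.d₁) = 0) ∧
      ∀ x v, lam (tensorHom x v) = DTrFunctional P (φ x) (Submodule.Quotient.mk v) := by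
  have := P.finite₀
  have := P.finite₁
  have := P.projective₀
  have := P.projective₁
  obtain ⟨n, e, c, hec⟩ := exists_dualBasis (A := A) P.P₁
  obtain ⟨m, e', c', hec'⟩ := exists_dualBasis (A := A) P.P₀
  let ψ (x : X) : P.Transpose →ₗ[K] K := DTrFunctional P (φ x)
  have hadd (x y t) : ψ (x + y) t = ψ x t + ψ y t := by
    change DTrFunctional P (φ (x + y)) t = _
    rw [map_add]
    rfl
  have hsmul (a : Aᵐᵒᵖ) (x t) : ψ (a • x) t = ψ x (a.unop • t) := by
    change DTrFunctional P (φ (a • x)) t = _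
    rw [map_smul]
    rfl
  let lam : (P.P₁ →ₗ[Aᵐᵒᵖ] X) →ₗ[K] K :=
    { toFun := fun v => ∑ j, ψ (v (e j)) (Submodule.Quotient.mk (c j))
      map_add' := fun v w => by simp [hadd, Finset.sum_add_distrib]
      map_smul' := fun r v => by
        rw [RingHom.id_apply, Finset.smul_sum]
        refine Finset.sum_congr rfl fun j _ => ?_
        rw [LinearMap.smul_apply, ← algebraMap_smul Aᵐᵒᵖ r (v (e j)), hsmul, ← map_smul]
        congr 1
        rw [MulOpposite.algebraMap_apply, unop_op, algebraMap_smul] }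
  have hlam (x) (v : P.P₁ →ₗ[Aᵐᵒᵖ] A) : lam (tensorHom x v) = ψ x (Submodule.Quotient.mk v) := by
    change ∑ j, ψ (op (v (e j)) • x) (Submodule.Quotient.mk (c j)) = _
    conv_rhs => rw [← sum_smul_dualBasis hec v]
    simp only [hsmul, unop_op, ← Submodule.Quotient.mk_smul]
    rw [← map_sum]
    congr 1
    exact (map_sum (Submodule.mkQ _) _ _).symm
  refine ⟨lam, fun k => ?_, hlam⟩
  rw [← sum_tensorHom hec' k]
  have : (∑ i, tensorHom (k (e' i)) (c' i)) ∘ₗ P.d₁ =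
      ∑ i, tensorHom (k (e' i)) (c' i ∘ₗ P.d₁) := by
    ext p
    simp
  rw [this, map_sum]
  refine Finset.sum_eq_zero fun i _ => ?_
  rw [hlam]
  have : (Submodule.Quotient.mk (c' i ∘ₗ P.d₁) : P.Transpose) = 0 :=
    (Submodule.Quotient.mk_eq_zero _).2 ⟨c' i, rfl⟩
  rw [this, map_zero]

/-- Restriction `Hom_A(Y, D Tr T) → Hom_A(X, D Tr T)` along `i : X → Y` is onto if and only if
`i` induces an injection `Coker (Hom(P₀, X) → Hom(P₁, X)) → Coker (Hom(P₀, Y) → Hom(P₁, Y))`. -/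
theorem forall_exists_comp_eq_DTr_iff_of_tower (i : X →ₗ[Aᵐᵒᵖ] Y) :
    (∀ φ : X →ₗ[Aᵐᵒᵖ] P.DTr K, ∃ ψ : Y →ₗ[Aᵐᵒᵖ] P.DTr K, ψ ∘ₗ i = φ) ↔
      ∀ g : P.P₁ →ₗ[Aᵐᵒᵖ] X, (∃ h : P.P₀ →ₗ[Aᵐᵒᵖ] Y, h ∘ₗ P.d₁ = i ∘ₗ g) →
        ∃ h : P.P₀ →ₗ[Aᵐᵒᵖ] X, h ∘ₗ P.d₁ = g := by
  let dX : (P.P₀ →ₗ[Aᵐᵒᵖ] X) →ₗ[K] (P.P₁ →ₗ[Aᵐᵒᵖ] X) :=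
    { toFun := fun h => h ∘ₗ P.d₁, map_add' := fun _ _ => rfl, map_smul' := fun _ _ => rfl }
  let dY : (P.P₀ →ₗ[Aᵐᵒᵖ] Y) →ₗ[K] (P.P₁ →ₗ[Aᵐᵒᵖ] Y) :=
    { toFun := fun h => h ∘ₗ P.d₁, map_add' := fun _ _ => rfl, map_smul' := fun _ _ => rfl }
  have hiK (r : K) (x : X) : i (r • x) = r • i x := LinearMap.map_smul_of_tower i r x
  let iP : (P.P₁ →ₗ[Aᵐᵒᵖ] X) →ₗ[K] (P.P₁ →ₗ[Aᵐᵒᵖ] Y) :=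
    { toFun := fun g => i ∘ₗ g
      map_add' := fun g g' => LinearMap.comp_add _ _ _
      map_smul' := fun r g => by ext p; simp [hiK] }
  have hi (x : X) (v : P.P₁ →ₗ[Aᵐᵒᵖ] A) : iP (tensorHom x v) = tensorHom (i x) v := by
    ext p
    simp [iP]
  constructor
  · rintro hφ g ⟨h, hh⟩
    by_contra hne
    have hg : g ∉ LinearMap.range dX := hne
    obtain ⟨lam, hlam, hle⟩ := Submodule.exists_le_ker_of_notMem hg
    obtain ⟨φ, hφ'⟩ := exists_hom_of_functional P lam fun k => hle ⟨k, rfl⟩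
    obtain ⟨ψ, rfl⟩ := hφ φ
    obtain ⟨mu, hmu, hmu'⟩ := exists_functional_of_hom P ψ
    have : lam = mu ∘ₗ iP := functional_ext P fun x v => by
      rw [← hφ' x v]
      exact ((congrArg mu (hi x v)).trans (hmu' (i x) v)).symm
    refine hlam ?_
    rw [this, LinearMap.comp_apply]
    exact (congrArg mu hh.symm).trans (hmu h)
  · intro hE φ
    obtain ⟨lam, hlam, hlam'⟩ := exists_functional_of_hom P φ
    -- extend the functional from the cokernel for `X` to the one for `Y`
    let j : (P.P₁ →ₗ[Aᵐᵒᵖ] X) ⧸ LinearMap.range dX →ₗ[K]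
        (P.P₁ →ₗ[Aᵐᵒᵖ] Y) ⧸ LinearMap.range dY :=
      (LinearMap.range dX).mapQ (LinearMap.range dY) iP (by
        rintro _ ⟨h, rfl⟩
        exact ⟨i ∘ₗ h, rfl⟩)
    have hj : LinearMap.ker j = ⊥ := by
      rw [eq_bot_iff]
      intro t ht
      obtain ⟨g, rfl⟩ := Submodule.Quotient.mk_surjective _ t
      have : iP g ∈ LinearMap.range dY := (Submodule.Quotient.mk_eq_zero _).1 ht
      exact (Submodule.Quotient.mk_eq_zero _).2 (hE g this)
    obtain ⟨l, hl⟩ := j.exists_leftInverse_of_injective hj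
    let lam₀ : (P.P₁ →ₗ[Aᵐᵒᵖ] X) ⧸ LinearMap.range dX →ₗ[K] K :=
      (LinearMap.range dX).liftQ lam (by
        rintro _ ⟨h, rfl⟩
        exact hlam h)
    let mu : (P.P₁ →ₗ[Aᵐᵒᵖ] Y) →ₗ[K] K := lam₀ ∘ₗ l ∘ₗ (LinearMap.range dY).mkQ
    obtain ⟨ψ, hψ⟩ := exists_hom_of_functional P mu fun k => by
      have : (LinearMap.range dY).mkQ (k ∘ₗ P.d₁) = 0 :=
        (Submodule.Quotient.mk_eq_zero _).2 ⟨k, rfl⟩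
      simp [mu, this]
    refine ⟨ψ, LinearMap.ext fun x => LinearMap.ext fun t => ?_⟩
    obtain ⟨v, rfl⟩ := Submodule.Quotient.mk_surjective _ t
    refine (hψ (i x) v).trans (Eq.trans ?_ (hlam' x v))
    have h1 : l (j (Submodule.Quotient.mk (tensorHom x v))) =
        Submodule.Quotient.mk (tensorHom x v) := LinearMap.congr_fun hl _
    rw [← hi]
    exact congrArg lam₀ h1

end Duality

section Translate

variable (K : Type u) [Field K] {A : Type u} [Ring A] [Algebra K A]
variable {T X Y : Type u} [AddCommGroup T] [Module Aᵐᵒᵖ T]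
  [AddCommGroup X] [Module Aᵐᵒᵖ X] [AddCommGroup Y] [Module Aᵐᵒᵖ Y]
  (P : MinimalProjectivePresentation Aᵐᵒᵖ T)

theorem forall_exists_comp_eq_DTr_iff (i : X →ₗ[Aᵐᵒᵖ] Y) :
    (∀ φ : X →ₗ[Aᵐᵒᵖ] P.DTr K, ∃ ψ : Y →ₗ[Aᵐᵒᵖ] P.DTr K, ψ ∘ₗ i = φ) ↔
      ∀ g : P.P₁ →ₗ[Aᵐᵒᵖ] X, (∃ h : P.P₀ →ₗ[Aᵐᵒᵖ] Y, h ∘ₗ P.d₁ = i ∘ₗ g) →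
        ∃ h : P.P₀ →ₗ[Aᵐᵒᵖ] X, h ∘ₗ P.d₁ = g := by
  let _ : Module K X := Module.compHom X (algebraMap K Aᵐᵒᵖ)
  have : IsScalarTower K Aᵐᵒᵖ X := .of_algebraMap_smul fun _ _ => rfl
  let _ : Module K Y := Module.compHom Y (algebraMap K Aᵐᵒᵖ)
  have : IsScalarTower K Aᵐᵒᵖ Y := .of_algebraMap_smul fun _ _ => rfl
  exact forall_exists_comp_eq_DTr_iff_of_tower P i

/-- `Hom(X, D Tr T) = 0` if and only if `Hom(P₀, X) → Hom(P₁, X)` is onto. -/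
theorem forall_hom_DTr_eq_zero_iff :
    (∀ φ : X →ₗ[Aᵐᵒᵖ] P.DTr K, φ = 0) ↔ ExtendsAlong P.d₁ X := by
  have := forall_exists_comp_eq_DTr_iff K P (0 : X →ₗ[Aᵐᵒᵖ] PUnit.{u + 1})
  simp only [LinearMap.comp_zero, exists_const, LinearMap.zero_comp] at this
  refine ⟨fun h g => this.1 (fun φ => (h φ).symm) g ⟨0, by simp⟩, fun h φ => ?_⟩
  exact (this.2 (fun g _ => h g) φ).symm

end Translate

/-! ### Indecomposable direct summands -/

section Indecomposable

variable {R : Type u} [Ring R] {M Z : Type u} [AddCommGroup M] [Module R M]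
  [AddCommGroup Z] [Module R Z]

theorem IsIndecomposable.of_linearEquiv (h : IsIndecomposable R M) (e : M ≃ₗ[R] Z) :
    IsIndecomposable R Z := by
  have := h.1
  refine ⟨e.symm.toEquiv.nontrivial, fun N N' hN => ?_⟩
  have := h.2 _ _ ((Submodule.orderIsoMapComap e.symm).isCompl hN)
  rcases this with h | h
  · left
    exact (map_eq_bot_iff (Submodule.orderIsoMapComap e.symm)).1 h
  · right
    exact (map_eq_bot_iff (Submodule.orderIsoMapComap e.symm)).1 h

/-- Fitting's lemma: the endomorphism ring of an indecomposable module of finite length is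
local. -/
theorem IsIndecomposable.isLocalRing_end [IsNoetherian R M] [IsArtinian R M]
    (h : IsIndecomposable R M) : IsLocalRing (Module.End R M) := by
  have := h.1
  refine IsLocalRing.of_isUnit_or_isUnit_one_sub_self fun e => ?_
  obtain ⟨k, hk, hk1⟩ :=
    (e.eventually_isCompl_ker_pow_range_pow.and (Filter.eventually_ge_atTop 1)).exists
  rcases h.2 _ _ hk with h | h
  · left
    have h' : LinearMap.range (e ^ k) = ⊤ := by simpa [h] using hk.sup_eq_top
    have : IsUnit (e ^ k) := (Module.End.isUnit_iff _).2
      ⟨LinearMap.ker_eq_bot.1 h, LinearMap.range_eq_top.1 h'⟩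
    exact (isUnit_pow_iff (by omega)).1 this
  · right
    exact IsNilpotent.isUnit_one_sub ⟨k, LinearMap.range_eq_bot.1 h⟩

/-- A split epimorphism from an indecomposable module onto a nonzero module is an isomorphism. -/
theorem IsIndecomposable.bijective_of_rightInverse [Nontrivial Z] (h : IsIndecomposable R M)
    (f : M →ₗ[R] Z) (g : Z →ₗ[R] M) (hfg : f ∘ₗ g = LinearMap.id) : Function.Bijective f := by
  have hfg' (z) : f (g z) = z := LinearMap.congr_fun hfg z
  have hc : IsCompl (LinearMap.range g) (LinearMap.ker (g.rangeRestrict ∘ₗ f)) :=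
    LinearMap.isCompl_of_proj (by
      rintro ⟨_, z, rfl⟩
      ext
      simp [hfg'])
  rcases h.2 _ _ hc with h | h
  · exfalso
    obtain ⟨z, hz⟩ := exists_ne (0 : Z)
    refine hz ?_
    have : g z = 0 := by
      rw [LinearMap.range_eq_bot.1 h, LinearMap.zero_apply]
    rw [← hfg' z, this, map_zero]
  · refine ⟨?_, fun z => ⟨g z, hfg' z⟩⟩
    rw [← LinearMap.ker_eq_bot, eq_bot_iff, ← h]
    intro x hx
    rw [LinearMap.mem_ker] at hx
    ext
    simp [hx]

theorem exists_isCompl_map (i : M →ₗ[R] Z) (r : Z →ₗ[R] M) (hri : r ∘ₗ i = LinearMap.id)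
    (N : Submodule R M) (hN : ∃ N', IsCompl N N') : ∃ N', IsCompl (N.map i) N' := by
  obtain ⟨N', hN⟩ := hN
  have hri' (x) : r (i x) = x := LinearMap.congr_fun hri x
  refine ⟨_, LinearMap.isCompl_of_proj (f := (i.restrict (p := N) (q := N.map i)
    fun x hx => ⟨x, hx, rfl⟩) ∘ₗ N.projectionOnto N' hN ∘ₗ r) ?_⟩
  rintro ⟨_, x, hx, rfl⟩
  have : N.projectionOnto N' hN x = ⟨x, hx⟩ :=
    Submodule.projectionOnto_apply_left hN ⟨x, hx⟩
  ext
  simp only [LinearMap.comp_apply, hri', this]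
  rfl

/-- The image of an indecomposable direct summand of `M` under a split monomorphism `M → Z`. -/
theorem exists_indecomposableSummand_of_retract (i : M →ₗ[R] Z) (r : Z →ₗ[R] M)
    (hri : r ∘ₗ i = LinearMap.id) (N : IndecomposableSummand R M) :
    ∃ N' : IndecomposableSummand R Z, Nonempty (N.1 ≃ₗ[R] N'.1) := by
  have e : N.1 ≃ₗ[R] N.1.map i :=
    Submodule.equivMapOfInjective i (LinearMap.injective_of_comp_eq_id _ _ hri) N.1
  exact ⟨⟨N.1.map i, N.2.1.of_linearEquiv e, exists_isCompl_map i r hri N.1 N.2.2⟩, ⟨e⟩⟩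

/-- Every direct summand of a module of finite length is a finite sum of indecomposable direct
summands. -/
theorem exists_finset_sup_eq [IsNoetherian R M] [IsArtinian R M] (N : Submodule R M)
    (hN : ∃ N', IsCompl N N') :
    ∃ s : Finset (Submodule R M), (∀ L ∈ s, IsIndecomposable R L ∧ ∃ L', IsCompl L L') ∧
      s.sup id = N := by
  classical
  induction N using WellFoundedLT.induction with
  | ind N ih =>
    by_cases h0 : N = ⊥
    · exact ⟨∅, by simp, by simp [h0]⟩
    by_cases hi : IsIndecomposable R N
    · exact ⟨{N}, by simpa using ⟨hi, hN⟩, by simp⟩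
    have hnt : Nontrivial N := Submodule.nontrivial_iff_ne_bot.2 h0
    obtain ⟨N₁, N₂, hc, h1, h2⟩ : ∃ N₁ N₂ : Submodule R N, IsCompl N₁ N₂ ∧ N₁ ≠ ⊥ ∧ N₂ ≠ ⊥ := by
      by_contra hcon
      refine hi ⟨hnt, fun N₁ N₂ hc => ?_⟩
      by_contra! hne
      exact hcon ⟨N₁, N₂, hc, hne.1, hne.2⟩
    obtain ⟨N', hN'⟩ := hN
    have hri : N.projectionOnto N' hN' ∘ₗ N.subtype = LinearMap.id := by
      ext x
      simp
    have hlt (L : Submodule R N) (hL : L ≠ ⊤) : L.map N.subtype < N := by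
      refine lt_of_le_of_ne (Submodule.map_subtype_le _ _) fun h => hL ?_
      refine Submodule.map_injective_of_injective N.injective_subtype ?_
      rw [h, Submodule.map_top, Submodule.range_subtype]
    obtain ⟨s₁, hs₁, hs₁'⟩ := ih _ (hlt N₁ fun h => h2 (by simpa [h] using hc.inf_eq_bot))
      (exists_isCompl_map _ _ hri N₁ ⟨N₂, hc⟩)
    obtain ⟨s₂, hs₂, hs₂'⟩ := ih _ (hlt N₂ fun h => h1 (by simpa [h] using hc.inf_eq_bot))
      (exists_isCompl_map _ _ hri N₂ ⟨N₁, hc.symm⟩)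
    refine ⟨s₁ ∪ s₂, fun L hL => ?_, ?_⟩
    · rcases Finset.mem_union.1 hL with h | h
      exacts [hs₁ L h, hs₂ L h]
    · rw [Finset.sup_union, hs₁', hs₂', ← Submodule.map_sup, hc.sup_eq_top, Submodule.map_top,
        Submodule.range_subtype]

/-- An indecomposable projective module of finite length has at most one maximal submodule. -/
theorem IsIndecomposable.eq_of_isCoatom [IsNoetherian R M] [IsArtinian R M] [Module.Projective R M]
    (h : IsIndecomposable R M) {N₁ N₂ : Submodule R M} (h₁ : IsCoatom N₁) (h₂ : IsCoatom N₂) :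
    N₁ = N₂ := by
  have := h.isLocalRing_end
  by_contra hne
  have hsup : N₂ ⊔ N₁ = ⊤ := by
    refine h₁.2 _ (lt_of_le_of_ne le_sup_right fun h => hne ?_)
    exact ((h₂.le_iff.1 (h ▸ le_sup_left)).resolve_left h₁.1)
  have hs : Function.Surjective (N₁.mkQ ∘ₗ N₂.subtype) := by
    rw [← LinearMap.range_eq_top, LinearMap.range_comp, Submodule.range_subtype,
      Submodule.map_mkQ_eq_top, sup_comm]
    exact hsup
  obtain ⟨g, hg⟩ := Module.projective_lifting_property _ N₁.mkQ hs
  -- `e` has image in `N₂` and is the identity modulo `N₁`, so neither `e` nor `1 - e` is onto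
  let e : Module.End R M := N₂.subtype ∘ₗ g
  have he : IsUnit (e + (1 - e)) := by simp
  rcases IsLocalRing.isUnit_or_isUnit_of_isUnit_add he with hu | hu
  · refine h₂.1 (eq_top_iff.2 fun x _ => ?_)
    obtain ⟨y, rfl⟩ := ((Module.End.isUnit_iff _).1 hu).2 x
    exact (g y).2
  · refine h₁.1 (eq_top_iff.2 fun x _ => ?_)
    obtain ⟨y, rfl⟩ := ((Module.End.isUnit_iff _).1 hu).2 x
    have := LinearMap.congr_fun hg y
    rw [← N₁.ker_mkQ, LinearMap.mem_ker, LinearMap.sub_apply, map_sub, sub_eq_zero]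
    exact this.symm

end Indecomposable

/-! ### Right approximations -/

section Approximation

variable (K : Type u) [Field K] {R : Type u} [Ring R] [Algebra K R]
variable {X Y : Type u} [AddCommGroup X] [Module R X] [Module K X] [IsScalarTower K R X]
  [AddCommGroup Y] [Module R Y] [Module K Y] [IsScalarTower K R Y]

/-- A finite-dimensional space `J` of homomorphisms `X → Y` consists of homomorphisms factoring
through one homomorphism `Xᵐ → Y`, whose components lie in `J`. -/
theorem exists_approximation (J : Submodule K (X →ₗ[R] Y)) (hJ : J.FG) :
    ∃ (m : ℕ) (F : (Fin m → X) →ₗ[R] Y), (∀ f ∈ J, ∃ v : X →ₗ[R] (Fin m → X), F ∘ₗ v = f) ∧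
      ∀ k, F ∘ₗ LinearMap.single R (fun _ => X) k ∈ J := by
  obtain ⟨m, f, hf⟩ := Submodule.fg_iff_exists_fin_generating_family.1 hJ
  refine ⟨m, LinearMap.lsum R (fun _ => X) ℕ f, fun g hg => ?_, fun k => ?_⟩
  · rw [← hf, Submodule.mem_span_range_iff_exists_fun] at hg
    obtain ⟨c, rfl⟩ := hg
    refine ⟨LinearMap.pi fun k => c k • LinearMap.id, ?_⟩
    ext x
    simp [LinearMap.lsum_apply, LinearMap.map_smul_of_tower]
  · rw [← hf]
    have : LinearMap.lsum R (fun _ => X) ℕ f ∘ₗ LinearMap.single R (fun _ => X) k = f k := by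
      ext x
      simp [LinearMap.lsum_apply, Pi.single_apply, apply_ite]
    rw [this]
    exact Submodule.subset_span ⟨k, rfl⟩

end Approximation

/-! ### The Euler pairing of a presentation with a module -/

section Euler

variable (K : Type u) [Field K] {R : Type u} [Ring R] [Algebra K R]

theorem finrank_eq_add_of_exact {U V W : Type u} [AddCommGroup U] [Module K U] [AddCommGroup V]
    [Module K V] [AddCommGroup W] [Module K W] [Module.Finite K V] (f : U →ₗ[K] V) (g : V →ₗ[K] W)
    (hf : Function.Injective f) (hg : Function.Surjective g) (hfg : Function.Exact f g) :
    Module.finrank K V = Module.finrank K U + Module.finrank K W := by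
  rw [← g.finrank_range_add_finrank_ker, hfg.linearMap_ker_eq, LinearMap.finrank_range_of_inj hf,
    LinearMap.range_eq_top.2 hg, finrank_top, add_comm]

/-- Composition with a homomorphism `f`, as a `K`-linear map. -/
def postcomp (Q : Type u) [AddCommGroup Q] [Module R Q] {M N : Type u}
    [AddCommGroup M] [Module R M] [Module K M] [IsScalarTower K R M]
    [AddCommGroup N] [Module R N] [Module K N] [IsScalarTower K R N] (f : M →ₗ[R] N) :
    (Q →ₗ[R] M) →ₗ[K] (Q →ₗ[R] N) where
  toFun g := f ∘ₗ g
  map_add' _ _ := LinearMap.comp_add _ _ _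
  map_smul' c g := by ext; simp [LinearMap.map_smul_of_tower]

variable {X : Type u} [AddCommGroup X] [Module R X]

/-- `dim Hom(P₀, M) - dim Hom(P₁, M)` for a minimal projective presentation `P₁ → P₀ → X`: the
pairing of the `g`-vector of `X` with the class of `M` in the Grothendieck group. -/
noncomputable def eulerHom (P : MinimalProjectivePresentation R X) (M : Type u) [AddCommGroup M]
    [Module R M] [Module K M] [IsScalarTower K R M] : ℚ :=
  Module.finrank K (P.P₀ →ₗ[R] M) - Module.finrank K (P.P₁ →ₗ[R] M)

variable {M N : Type u} [AddCommGroup M] [Module R M] [Module K M] [IsScalarTower K R M]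
  [AddCommGroup N] [Module R N] [Module K N] [IsScalarTower K R N]

theorem finrank_hom_eq_of_linearEquiv (Q : Type u) [AddCommGroup Q] [Module R Q] (e : M ≃ₗ[R] N) :
    Module.finrank K (Q →ₗ[R] M) = Module.finrank K (Q →ₗ[R] N) := by
  refine LinearEquiv.finrank_eq (LinearEquiv.ofBijective (postcomp K Q e.toLinearMap) ⟨?_, ?_⟩)
  · intro f g hfg
    ext x
    exact e.injective (LinearMap.congr_fun hfg x)
  · intro f
    refine ⟨e.symm.toLinearMap ∘ₗ f, ?_⟩
    ext x
    simp [postcomp]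

theorem eulerHom_eq_of_linearEquiv (P : MinimalProjectivePresentation R X) (e : M ≃ₗ[R] N) :
    eulerHom K P M = eulerHom K P N := by
  rw [eulerHom, eulerHom, finrank_hom_eq_of_linearEquiv K _ e, finrank_hom_eq_of_linearEquiv K _ e]

theorem finrank_hom_of_projective [Module.Finite K M] (L : Submodule R M) (Q : Type u)
    [AddCommGroup Q] [Module R Q] [Module.Finite R Q] [Module.Projective R Q] :
    Module.finrank K (Q →ₗ[R] M) =
      Module.finrank K (Q →ₗ[R] L) + Module.finrank K (Q →ₗ[R] M ⧸ L) := by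
  have := finite_hom (R := R) K Q M
  refine finrank_eq_add_of_exact K (postcomp K Q L.subtype) (postcomp K Q L.mkQ) ?_ ?_ ?_
  · intro f g hfg
    ext x
    exact LinearMap.congr_fun hfg x
  · intro f
    exact Module.projective_lifting_property _ f L.mkQ_surjective
  · intro f
    constructor
    · intro hf
      refine ⟨f.codRestrict L fun x => ?_, LinearMap.ext fun _ => rfl⟩
      exact (Submodule.Quotient.mk_eq_zero L).1 (LinearMap.congr_fun hf x)
    · rintro ⟨g, rfl⟩
      ext x
      simp [postcomp]

theorem eulerHom_eq_add [Module.Finite K M] (P : MinimalProjectivePresentation R X)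
    (L : Submodule R M) : eulerHom K P M = eulerHom K P L + eulerHom K P (M ⧸ L) := by
  have := P.finite₀
  have := P.finite₁
  have := P.projective₀
  have := P.projective₁
  rw [eulerHom, eulerHom, eulerHom, finrank_hom_of_projective K L P.P₀,
    finrank_hom_of_projective K L P.P₁]
  push_cast
  ring

/-- For modules with extensions along the presentation of `X`, `eulerHom` computes
`dim Hom(X, M)`. -/
theorem eulerHom_eq_finrank [Module.Finite K M] (P : MinimalProjectivePresentation R X)
    (hM : ExtendsAlong P.d₁ M) : eulerHom K P M = Module.finrank K (X →ₗ[R] M) := by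
  have := P.finite₀
  have := finite_hom (R := R) K P.P₀ M
  have hPd (x) : P.d₀ (P.d₁ x) = 0 := by
    rw [← LinearMap.mem_ker, ← P.exact]; exact ⟨x, rfl⟩
  have h := finrank_eq_add_of_exact K
    ({ toFun := fun f => f ∘ₗ P.d₀, map_add' := fun _ _ => rfl, map_smul' := fun _ _ => rfl } :
      (X →ₗ[R] M) →ₗ[K] (P.P₀ →ₗ[R] M))
    ({ toFun := fun f => f ∘ₗ P.d₁, map_add' := fun _ _ => rfl, map_smul' := fun _ _ => rfl } :
      (P.P₀ →ₗ[R] M) →ₗ[K] (P.P₁ →ₗ[R] M))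
    (fun f g hfg => (LinearMap.cancel_right P.surjective).1 hfg) hM (fun f => by
      constructor
      · intro hf
        refine exists_comp_eq_of_ker_le P.surjective f ?_
        rw [← P.exact]
        rintro _ ⟨x, rfl⟩
        exact LinearMap.congr_fun hf x
      · rintro ⟨g, rfl⟩
        ext x
        simp [hPd])
  rw [eulerHom, h]
  push_cast
  ring

/-- The vectors of Euler pairings with arbitrary modules lie in any subspace containing those of
the simple modules. -/
theorem eulerHom_mem_of_simple {ι : Type*} {Y : ι → Type u} [∀ i, AddCommGroup (Y i)]
    [∀ i, Module R (Y i)] (P : ∀ i, MinimalProjectivePresentation R (Y i))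
    (W : Submodule ℚ (ι → ℚ))
    (hW : ∀ (S : Type u) [AddCommGroup S] [Module R S] [Module K S] [IsScalarTower K R S],
      IsSimpleModule R S → (fun i => eulerHom K (P i) S) ∈ W)
    {M : Type u} [AddCommGroup M] [Module R M] (hM : IsFiniteLength R M) :
    ∀ [Module K M] [IsScalarTower K R M] [Module.Finite K M],
      (fun i => eulerHom K (P i) M) ∈ W := by
  induction hM with
  | of_subsingleton =>
    intro _ _ _
    convert W.zero_mem using 1
    ext i
    rw [eulerHom, Module.finrank_zero_of_subsingleton, Module.finrank_zero_of_subsingleton]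
    simp
  | @of_simple_quotient M _ _ N _ _ ih =>
    intro _ _ _
    have : Module.Finite K N :=
      Module.Finite.of_injective (N.subtype.restrictScalars K) N.injective_subtype
    have := W.add_mem ih (hW (M ⧸ N) inferInstance)
    convert this using 1
    ext i
    exact eulerHom_eq_add K (P i) N

end Euler

/-! ### The number of indecomposable direct summands -/

section Counting

variable (K : Type u) [Field K] {R : Type u} [Ring R] [Algebra K R]
variable {X : Type u} [AddCommGroup X] [Module R X] [Module K X] [IsScalarTower K R X]

theorem finite_restrictScalars [Module.Finite K R] (M : Type u) [AddCommGroup M] [Module R M]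
    [Module K M] [IsScalarTower K R M] [Module.Finite R M] : Module.Finite K M :=
  Module.Finite.trans R M

/-- Let `Y` be an indecomposable submodule of `X`. There are `M ∈ Fac X` and `q : M → Y` such that,
for every direct summand `Z` of `X` whose presentation admits extensions to all modules in `Fac X`,
composition with `q` is an injection `Hom(Z, M) → Hom(Z, Y)`. It is onto if `Z` is indecomposable
and not isomorphic to `Y`, and no isomorphism `Z → Y` is in its image.

Finitely many radical homomorphisms spanning all of them form `F : Xᵐ → Y`, through which every
radical homomorphism `X → Y` factors; `M` is the quotient of `Xᵐ` by the trace of `X` in the kernel of `F`. -/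
theorem exists_radical_memFac [Module.Finite K R] [Module.Finite R X] (Y : Submodule R X)
    (hY : IsIndecomposable R Y) :
    ∃ (M : Type u) (_ : AddCommGroup M) (_ : Module R M) (_ : Module K M)
      (_ : IsScalarTower K R M) (_ : Module.Finite R M) (q : M →ₗ[R] Y), MemFac R X M ∧
      ∀ (Z : Submodule R X) (π : X →ₗ[R] Z), π ∘ₗ Z.subtype = LinearMap.id →
        ∀ (P : MinimalProjectivePresentation R Z),
        (∀ (L : Type u) [AddCommGroup L] [Module R L], MemFac R X L → ExtendsAlong P.d₁ L) →
        (∀ f : Z →ₗ[R] M, q ∘ₗ f = 0 → f = 0) ∧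
        (IsIndecomposable R Z → IsEmpty (Z ≃ₗ[R] Y) → ∀ f : Z →ₗ[R] Y, ∃ f', q ∘ₗ f' = f) ∧
        (∀ f : Z →ₗ[R] M, ¬ Function.Bijective (q ∘ₗ f)) := by
  have : IsArtinianRing R := IsArtinianRing.of_finite K R
  have := hY.isLocalRing_end
  have := hY.1
  have := finite_restrictScalars K (R := R) X
  have : Module.Finite K Y :=
    Module.Finite.of_injective (Y.subtype.restrictScalars K) Y.injective_subtype
  have := finite_hom (R := R) K X Y
  -- `J` consists of the radical homomorphisms; it is a subspace because `End Y` is local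
  let J : Submodule K (X →ₗ[R] Y) :=
    { carrier := {f | ∀ g : Y →ₗ[R] X, ¬ IsUnit (f ∘ₗ g : Module.End R Y)}
      zero_mem' := fun g => by
        rw [LinearMap.zero_comp]
        exact not_isUnit_zero
      add_mem' := fun {f f'} hf hf' g hu => by
        rw [LinearMap.add_comp] at hu
        exact (IsLocalRing.isUnit_or_isUnit_of_isUnit_add hu).elim (hf g) (hf' g)
      smul_mem' := fun c f hf g hu => by
        refine hf (c • g) ?_
        convert hu using 1
        ext x
        simp [LinearMap.map_smul_of_tower] }
  obtain ⟨m, F, hF, hF'⟩ := exists_approximation K J (IsNoetherian.noetherian J)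
  have : Module.Finite K (LinearMap.ker F) := Module.Finite.of_injective
    ((LinearMap.ker F).subtype.restrictScalars K) (LinearMap.ker F).injective_subtype
  have hfin := finite_hom (R := R) K X (LinearMap.ker F)
  -- the range of `G` is the trace of `X` in the kernel of `F`
  obtain ⟨l, G, hG, -⟩ := exists_approximation K (⊤ : Submodule K (X →ₗ[R] LinearMap.ker F))
    hfin.fg_top
  let t : Submodule R (Fin m → X) := LinearMap.range ((LinearMap.ker F).subtype ∘ₗ G)
  have htX : MemFac R X t := ⟨l, _, LinearMap.surjective_rangeRestrict _⟩
  let q : ((Fin m → X) ⧸ t) →ₗ[R] Y := t.liftQ F (by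
    rintro _ ⟨x, rfl⟩
    exact (G x).2)
  refine ⟨(Fin m → X) ⧸ t, inferInstance, inferInstance, inferInstance, inferInstance,
    inferInstance, q, ⟨m, t.mkQ, t.mkQ_surjective⟩, fun Z π hπ P hP => ?_⟩
  have := P.projective₀
  have hlift (f : Z →ₗ[R] (Fin m → X) ⧸ t) : ∃ f' : Z →ₗ[R] (Fin m → X), t.mkQ ∘ₗ f' = f :=
    exists_lift_of_extendsAlong P.surjective P.exact t.mkQ t.mkQ_surjective
      (by rw [Submodule.ker_mkQ]; exact hP t htX) f
  have hπ' (z : Z) : π z = z := LinearMap.congr_fun hπ z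
  refine ⟨fun f hf => ?_, fun hZ hne f => ?_, fun f hf => ?_⟩
  · obtain ⟨f', rfl⟩ := hlift f
    have hf' (z : Z) : F (f' z) = 0 := LinearMap.congr_fun hf z
    obtain ⟨v, hv⟩ := hG ((f' ∘ₗ π).codRestrict (LinearMap.ker F) fun x => hf' _) trivial
    ext z
    refine (Submodule.Quotient.mk_eq_zero t).2 ⟨v z, ?_⟩
    have := congrArg Subtype.val (LinearMap.congr_fun hv z)
    exact this.trans (congrArg f' (hπ' z))
  · have hfJ : f ∘ₗ π ∈ J := by
      intro g hu
      obtain ⟨w, hw⟩ := hu.exists_right_inv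
      have hb := hZ.bijective_of_rightInverse f (π ∘ₗ g ∘ₗ w) hw
      exact hne.false (LinearEquiv.ofBijective f hb)
    obtain ⟨v, hv⟩ := hF _ hfJ
    refine ⟨t.mkQ ∘ₗ v ∘ₗ Z.subtype, ?_⟩
    ext z
    have := congrArg Subtype.val (LinearMap.congr_fun hv z)
    simpa [q, hπ'] using this
  · obtain ⟨f', rfl⟩ := hlift f
    let e := LinearEquiv.ofBijective _ hf
    -- the identity of `Y` would be a sum of non-units
    have hsum : ∑ k, (F ∘ₗ LinearMap.single R (fun _ => X) k) ∘ₗ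
        (LinearMap.proj k ∘ₗ f' ∘ₗ e.symm.toLinearMap) = (1 : Module.End R Y) := by
      ext y
      have h1 : e (e.symm y) = y := e.apply_symm_apply y
      have h2 : F (f' (e.symm y)) = e (e.symm y) := rfl
      conv_rhs => rw [Module.End.one_apply, ← h1, ← h2]
      simp [← map_sum, LinearMap.sum_single_apply]
    obtain ⟨k, -, hk⟩ := IsLocalRing.exists_of_isUnit_sum (R := Module.End R Y)
      (s := Finset.univ) (hsum ▸ isUnit_one)
    exact hF' k _ hk

/-- Pairwise nonisomorphic indecomposable direct summands `Yᵢ` of `X`, along whose minimal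
presentations homomorphisms to modules in `Fac X` extend, are at most as many as the simple modules.

The vectors `(eulerHom (P i) M)ᵢ` lie in the span of those of the simple modules. The one of `Yⱼ`
minus the one of the module given by `exists_radical_memFac` is a nonzero multiple of the `j`-th
unit vector, so these vectors span the whole space. -/
theorem card_le_of_extendsAlong [Module.Finite K R] [Module.Finite R X]
    {κ : Type*} [Fintype κ] (S : κ → Type u) [∀ k, AddCommGroup (S k)] [∀ k, Module R (S k)]
    (hS : ∀ (V : Type u) [AddCommGroup V] [Module R V], IsSimpleModule R V →
      ∃ k, Nonempty (V ≃ₗ[R] S k))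
    {ι : Type*} [Fintype ι] (Y : ι → Submodule R X) (hY : ∀ i, IsIndecomposable R (Y i))
    (hne : ∀ i j, i ≠ j → IsEmpty (Y i ≃ₗ[R] Y j)) (π : ∀ i, X →ₗ[R] Y i)
    (hπ : ∀ i, π i ∘ₗ (Y i).subtype = LinearMap.id)
    (P : ∀ i, MinimalProjectivePresentation R (Y i))
    (hP : ∀ i (L : Type u) [AddCommGroup L] [Module R L], MemFac R X L →
      ExtendsAlong (P i).d₁ L) :
    Fintype.card ι ≤ Fintype.card κ := by
  classical
  have : IsArtinianRing R := IsArtinianRing.of_finite K R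
  let _ (k : κ) : Module K (S k) := Module.compHom (S k) (algebraMap K R)
  have (k : κ) : IsScalarTower K R (S k) := .of_algebraMap_smul fun _ _ => rfl
  let v (k : κ) (i : ι) : ℚ := eulerHom K (P i) (S k)
  let W : Submodule ℚ (ι → ℚ) := Submodule.span ℚ (Set.range v)
  have hW (M : Type u) [AddCommGroup M] [Module R M] [Module K M] [IsScalarTower K R M]
      [Module.Finite R M] : (fun i => eulerHom K (P i) M) ∈ W := by
    have := finite_restrictScalars K (R := R) M
    refine eulerHom_mem_of_simple K P W (fun V _ _ _ _ hV => ?_)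
      (isFiniteLength_iff_isNoetherian_isArtinian.2 ⟨inferInstance, inferInstance⟩)
    obtain ⟨k, ⟨e⟩⟩ := hS V hV
    refine Submodule.subset_span ⟨k, funext fun i => ?_⟩
    exact (eulerHom_eq_of_linearEquiv K (P i) e).symm
  have := finite_restrictScalars K (R := R) X
  have hsingle (j : ι) : Pi.single j (1 : ℚ) ∈ W := by
    obtain ⟨M, _, _, _, _, _, q, hMX, hM⟩ := exists_radical_memFac K (Y j) (hY j)
    have := finite_restrictScalars K (R := R) M
    have : Module.Finite K (Y j) := finite_restrictScalars K (R := R) (Y j)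
    have hYX : MemFac R X (Y j) := ⟨1, π j ∘ₗ LinearMap.proj 0, fun y =>
      ⟨fun _ => y, LinearMap.congr_fun (hπ j) y⟩⟩
    have hd := W.sub_mem (hW (Y j)) (hW M)
    let D (i : ι) : ℚ :=
      Module.finrank K (Y i →ₗ[R] Y j) - Module.finrank K (Y i →ₗ[R] M)
    have hD : D ∈ W := by
      convert hd using 1
      ext i
      rw [Pi.sub_apply, eulerHom_eq_finrank K (P i) (hP i _ hYX),
        eulerHom_eq_finrank K (P i) (hP i _ hMX)]
    have hinj (i : ι) : Function.Injective (postcomp K (Y i) q) :=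
      (injective_iff_map_eq_zero _).2 (hM (Y i) (π i) (hπ i) (P i) (hP i)).1
    have hDi (i : ι) (hij : i ≠ j) : D i = 0 := by
      have := LinearEquiv.finrank_eq (LinearEquiv.ofBijective _ ⟨hinj i,
        (hM (Y i) (π i) (hπ i) (P i) (hP i)).2.1 (hY i) (hne i j hij)⟩)
      simp [D, this]
    have hDj : D j ≠ 0 := by
      have := finite_hom (R := R) K (Y j) (Y j)
      have hlt : Module.finrank K (LinearMap.range (postcomp K (Y j) q)) <
          Module.finrank K (Y j →ₗ[R] Y j) := by
        refine Submodule.finrank_lt fun htop => ?_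
        obtain ⟨f, hf⟩ := LinearMap.range_eq_top.1 htop LinearMap.id
        refine (hM (Y j) (π j) (hπ j) (P j) (hP j)).2.2 f ?_
        change Function.Bijective (postcomp K (Y j) q f)
        rw [hf]
        exact Function.bijective_id
      rw [LinearMap.finrank_range_of_inj (hinj j)] at hlt
      have : (Module.finrank K (Y j →ₗ[R] M) : ℚ) < Module.finrank K (Y j →ₗ[R] Y j) :=
        mod_cast hlt
      simp only [D]
      linarith
    have : Pi.single j (1 : ℚ) = (D j)⁻¹ • D := by
      ext i
      by_cases hij : i = j
      · subst hij
        simp [hDj]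
      · simp [hij, hDi i hij]
    rw [this]
    exact W.smul_mem _ hD
  have htop : W = ⊤ := by
    refine eq_top_iff.2 fun w _ => ?_
    rw [pi_eq_sum_univ' w]
    refine W.sum_mem fun i _ => W.smul_mem _ ?_
    convert hsingle i using 1
  have h1 := finrank_range_le_card (R := ℚ) v
  rw [Set.finrank] at h1
  change Module.finrank ℚ W ≤ _ at h1
  rwa [htop, finrank_top, Module.finrank_fintype_fun_eq_card] at h1

end Counting

section Number

variable {R : Type u} [Ring R] [IsArtinianRing R]

/-- If `G` is a finitely generated projective generator, the simple modules are the tops of its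
indecomposable direct summands, so there are at most `|G|` of them. -/
theorem exists_finset_simple (G : Type u) [AddCommGroup G] [Module R G] [Module.Finite R G]
    [Module.Projective R G]
    (hG : ∀ (V : Type u) [AddCommGroup V] [Module R V], IsSimpleModule R V →
      ∃ f : G →ₗ[R] V, f ≠ 0) :
    ∃ (I : Finset (Quotient (isoSetoid R G))) (L : ∀ c : I, Submodule R c.1.out.1),
      ∀ (V : Type u) [AddCommGroup V] [Module R V], IsSimpleModule R V →
        ∃ c, Nonempty (V ≃ₗ[R] (c.1.out.1 ⧸ L c)) := by
  classical
  obtain ⟨s, hs, hsup⟩ := exists_finset_sup_eq (⊤ : Submodule R G) ⟨⊥, isCompl_top_bot⟩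
  let cls (N : s) : Quotient (isoSetoid R G) := Quotient.mk _ ⟨N.1, hs N.1 N.2⟩
  have hmax (c : Quotient (isoSetoid R G)) : ∃ L : Submodule R c.out.1, IsCoatom L := by
    have := c.out.2.1.1
    obtain ⟨L, hL, -⟩ := (eq_top_or_exists_le_coatom (⊥ : Submodule R c.out.1)).resolve_left
      bot_ne_top
    exact ⟨L, hL⟩
  choose L hL using hmax
  refine ⟨Finset.univ.image cls, fun c => L c.1, fun V _ _ hV => ?_⟩
  obtain ⟨f, hf⟩ := hG V hV
  obtain ⟨N, hN⟩ : ∃ N : s, f ∘ₗ N.1.subtype ≠ 0 := by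
    by_contra! h
    refine hf (LinearMap.ker_eq_top.1 (eq_top_iff.2 (hsup ▸ Finset.sup_le fun N hN x hx => ?_)))
    exact LinearMap.congr_fun (h ⟨N, hN⟩) ⟨x, hx⟩
  refine ⟨⟨cls N, Finset.mem_image_of_mem _ (Finset.mem_univ _)⟩, ?_⟩
  obtain ⟨e⟩ : Nonempty ((cls N).out.1 ≃ₗ[R] N.1) := Quotient.mk_out (s := isoSetoid R G) _
  let g : (cls N).out.1 →ₗ[R] V := (f ∘ₗ N.1.subtype) ∘ₗ e.toLinearMap
  have hg : Function.Surjective g := by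
    have h1 := LinearMap.surjective_of_ne_zero hN
    exact h1.comp e.surjective
  have : Module.Projective R (cls N).out.1 := by
    obtain ⟨N', hc⟩ := (cls N).out.2.2
    refine Module.Projective.of_split (Submodule.subtype _) (Submodule.projectionOnto _ N' hc) ?_
    ext x
    simp
  have hker : LinearMap.ker g = L (cls N) :=
    (cls N).out.2.1.eq_of_isCoatom (LinearMap.isCoatom_ker_of_surjective hg) (hL _)
  exact ⟨((Submodule.quotEquivOfEq _ _ hker).symm.trans (g.quotKerEquivOfSurjective hg)).symm⟩

theorem card_le_of_forall_finset {α : Type u} {n : ℕ} (h : ∀ t : Finset α, t.card ≤ n) :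
    ENat.card α ≤ n := by
  have : Finite α := by
    by_contra hinf
    have := not_finite_iff_infinite.1 hinf
    obtain ⟨t, ht⟩ := Infinite.exists_subset_card_eq α (n + 1)
    have := h t
    omega
  have := Fintype.ofFinite α
  rw [ENat.card_eq_coe_fintype_card]
  exact_mod_cast h Finset.univ

/-- A module `X` with a projective presentation along which homomorphisms to `X` extend (such as a
`τ`-rigid module) has finitely many indecomposable direct summands up to isomorphism, at most as
many as the finitely generated projective generator `G`. -/
theorem numIndecomposableSummands_le (K : Type u) [Field K] [Algebra K R] [Module.Finite K R]
    (G : Type u) [AddCommGroup G] [Module R G] [Module.Finite R G] [Module.Projective R G]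
    (hG : ∀ (V : Type u) [AddCommGroup V] [Module R V], IsSimpleModule R V →
      ∃ f : G →ₗ[R] V, f ≠ 0)
    {X : Type u} [AddCommGroup X] [Module R X] [Module.Finite R X]
    {Q₁ Q₀ : Type u} [AddCommGroup Q₁] [Module R Q₁] [AddCommGroup Q₀] [Module R Q₀]
    [Module.Projective R Q₁] [Module.Projective R Q₀] {d : Q₁ →ₗ[R] Q₀} {d₀ : Q₀ →ₗ[R] X}
    (hd₀ : Function.Surjective d₀) (hex : LinearMap.range d = LinearMap.ker d₀)
    (hX : ExtendsAlong d X) :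
    numIndecomposableSummands R X ≤ numIndecomposableSummands R G ∧
      numIndecomposableSummands R X ≠ ⊤ := by
  let _ : Module K X := Module.compHom X (algebraMap K R)
  have : IsScalarTower K R X := .of_algebraMap_smul fun _ _ => rfl
  obtain ⟨I, L, hI⟩ := exists_finset_simple G hG
  have hle : numIndecomposableSummands R X ≤ I.card := by
    refine card_le_of_forall_finset fun t => ?_
    have hcompl (c : t) : ∃ π : X →ₗ[R] c.1.out.1, π ∘ₗ (c.1.out.1).subtype = LinearMap.id := by
      obtain ⟨N', hc⟩ := c.1.out.2.2
      exact ⟨Submodule.projectionOnto _ N' hc, by ext x; simp⟩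
    choose π hπ using hcompl
    have := card_le_of_extendsAlong K (fun c : I => c.1.out.1 ⧸ L c) hI
      (fun c : t => c.1.out.1) (fun c => c.1.out.2.1)
      (fun i j hij => ⟨fun e => hij (Subtype.ext (by
        rw [← Quotient.out_eq i.1, ← Quotient.out_eq j.1]
        exact Quotient.sound ⟨e⟩))⟩) π hπ
      (fun c => (nonempty_minimalProjectivePresentation R _).some)
      (fun c Z _ _ hZ => (hX.of_memFac hZ).of_retract hd₀ hex _ (c.1.out.1).subtype (π c) (hπ c))
    simpa using this
  refine ⟨hle.trans ?_, fun h => ?_⟩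
  · rw [numIndecomposableSummands, ← Set.encard_coe_eq_coe_finsetCard]
    exact Set.encard_le_card
  · rw [h] at hle
    exact absurd hle (by simp)

end Number

/-! ### The class of modules generated by a module -/

section Fac

variable {R : Type u} [Ring R] {T M N : Type u} [AddCommGroup T] [Module R T]
  [AddCommGroup M] [Module R M] [AddCommGroup N] [Module R N]

theorem MemFac.of_surjective (hM : MemFac R T M) (f : M →ₗ[R] N) (hf : Function.Surjective f) :
    MemFac R T N := by
  obtain ⟨n, g, hg⟩ := hM
  exact ⟨n, f ∘ₗ g, hf.comp hg⟩

theorem memFac_of_finite {ι : Type} [Finite ι] (f : (ι → T) →ₗ[R] M) (hf : Function.Surjective f) :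
    MemFac R T M := by
  have := Fintype.ofFinite ι
  exact ⟨Fintype.card ι, f ∘ₗ (LinearEquiv.funCongrLeft R T (Fintype.equivFin ι)).toLinearMap,
    hf.comp (LinearEquiv.surjective _)⟩

theorem MemFac.trans (hMT : MemFac R T M) (hNM : MemFac R M N) : MemFac R T N := by
  obtain ⟨n, f, hf⟩ := hNM
  obtain ⟨m, g, hg⟩ := hMT
  let e := LinearEquiv.curry R T (Fin n) (Fin m)
  have h : Function.Surjective (LinearMap.pi fun i => g ∘ₗ LinearMap.proj i :
      (Fin n → Fin m → T) →ₗ[R] (Fin n → M)) := fun y => by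
    choose x hx using fun i => hg (y i)
    exact ⟨x, funext hx⟩
  exact memFac_of_finite (ι := Fin n × Fin m) ((f ∘ₗ LinearMap.pi _) ∘ₗ e.toLinearMap)
    ((hf.comp h).comp e.surjective)

theorem MemFac.sup {L L' : Submodule R M} (hL : MemFac R T L) (hL' : MemFac R T L') :
    MemFac R T (L ⊔ L' : Submodule R M) := by
  obtain ⟨n, f, hf⟩ := hL
  obtain ⟨n', f', hf'⟩ := hL'
  let g : (Fin n → T) × (Fin n' → T) →ₗ[R] (L ⊔ L' : Submodule R M) :=
    (Submodule.inclusion le_sup_left ∘ₗ f).coprod (Submodule.inclusion le_sup_right ∘ₗ f')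
  have hg : Function.Surjective g := by
    rintro ⟨x, hx⟩
    obtain ⟨y, hy, z, hz, rfl⟩ := Submodule.mem_sup.1 hx
    obtain ⟨a, ha⟩ := hf ⟨y, hy⟩
    obtain ⟨b, hb⟩ := hf' ⟨z, hz⟩
    refine ⟨(a, b), Subtype.ext ?_⟩
    simp [g, ha, hb]
  let e := LinearEquiv.sumArrowLequivProdArrow (Fin n) (Fin n') R T
  exact memFac_of_finite (ι := Fin n ⊕ Fin n') (g ∘ₗ e.toLinearMap) (hg.comp e.surjective)

theorem memFac_finset_sup (s : Finset (Submodule R M)) (hs : ∀ L ∈ s, MemFac R T L) :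
    MemFac R T (s.sup id : Submodule R M) := by
  classical
  induction s using Finset.induction_on with
  | empty =>
    refine ⟨0, 0, fun x => ⟨0, ?_⟩⟩
    have : Subsingleton ((∅ : Finset (Submodule R M)).sup id : Submodule R M) := by
      rw [Finset.sup_empty]; infer_instance
    exact Subsingleton.elim _ _
  | insert L s _ ih =>
    rw [Finset.sup_insert]
    exact (hs L (Finset.mem_insert_self _ _)).sup
      (ih fun L' h => hs L' (Finset.mem_insert_of_mem h))

theorem ker_prodMap_eq_range {M₁ M₂ M₃ N₁ N₂ N₃ : Type u} [AddCommGroup M₁] [Module R M₁]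
    [AddCommGroup M₂] [Module R M₂] [AddCommGroup M₃] [Module R M₃] [AddCommGroup N₁] [Module R N₁]
    [AddCommGroup N₂] [Module R N₂] [AddCommGroup N₃] [Module R N₃]
    {f : M₁ →ₗ[R] M₂} {g : M₂ →ₗ[R] M₃} {f' : N₁ →ₗ[R] N₂} {g' : N₂ →ₗ[R] N₃}
    (h : LinearMap.range f = LinearMap.ker g) (h' : LinearMap.range f' = LinearMap.ker g') :
    LinearMap.range (f.prodMap f') = LinearMap.ker (g.prodMap g') := by
  rw [LinearMap.range_prodMap, LinearMap.ker_prodMap, h, h']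

end Fac

/-! ### Modules generated by a τ-tilting module -/

section TauTilting

variable (K : Type u) [Field K] {A : Type u} [Ring A] [Algebra K A] [Module.Finite K A]

theorem finite_algebra_op : Module.Finite K Aᵐᵒᵖ :=
  Module.Finite.equiv (MulOpposite.opLinearEquiv K : A ≃ₗ[K] Aᵐᵒᵖ)

variable (A)

variable (T : Type u) [AddCommGroup T] [Module Aᵐᵒᵖ T] [Module.Finite Aᵐᵒᵖ T]

theorem IsTauRigid.extendsAlong (hT : IsTauRigid K A T) :
    ExtendsAlong (minimalPresentation K A T).d₁ T :=
  (forall_hom_DTr_eq_zero_iff K (minimalPresentation K A T)).1 hT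

/-- For a `τ`-tilting module `T`, every finitely generated `X` with `Hom(X, τ T) = 0` lies in
`Fac T`. The Bongartz completion `V ⊕ T` has no more indecomposable summands than `A`, hence none
besides those of `T`. -/
theorem IsTauTilting.memFac (hT : IsTauTilting K A T) (X : Type u) [AddCommGroup X]
    [Module Aᵐᵒᵖ X] [Module.Finite Aᵐᵒᵖ X]
    (hX : ExtendsAlong (minimalPresentation K A T).d₁ X) : MemFac Aᵐᵒᵖ T X := by
  have : IsArtinianRing Aᵐᵒᵖ := isArtinianRing_op K A
  have : Module.Finite K Aᵐᵒᵖ := finite_algebra_op K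
  let P := minimalPresentation K A T
  change ExtendsAlong P.d₁ X at hX
  have := P.finite₀
  have := P.finite₁
  have := P.projective₀
  have := P.projective₁
  have hTT : ExtendsAlong P.d₁ T := hT.1.extendsAlong
  obtain ⟨r, f, hf⟩ := Submodule.fg_iff_exists_fin_generating_family.1
    (finite_hom (R := Aᵐᵒᵖ) K P.P₁ Aᵐᵒᵖ).fg_top
  let V := BongartzComplement P.d₁ f
  have hV : ExtendsAlong P.d₁ V :=
    hTT.bongartzComplement f K P.surjective P.exact hf
  have : Module.Projective Aᵐᵒᵖ (Fin r → P.P₁) :=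
    Module.Projective.of_equiv (DFinsupp.linearEquivFunOnFintype (R := Aᵐᵒᵖ))
  have : Module.Projective Aᵐᵒᵖ (Fin r → P.P₀) :=
    Module.Projective.of_equiv (DFinsupp.linearEquivFunOnFintype (R := Aᵐᵒᵖ))
  have hVT := (hV.prod hTT).bongartzMap_prodMap f
  have : Module.Finite Aᵐᵒᵖ A := Module.Finite.equiv (unopLinearEquiv A)
  have : Module.Projective Aᵐᵒᵖ A := Module.Projective.of_equiv (unopLinearEquiv A)
  obtain ⟨hle, hne⟩ := numIndecomposableSummands_le K A (fun U _ _ hU => by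
      have := IsSimpleModule.nontrivial Aᵐᵒᵖ U
      obtain ⟨x, hx⟩ := exists_ne (0 : U)
      refine ⟨LinearMap.toSpanSingleton Aᵐᵒᵖ U x ∘ₗ (unopLinearEquiv A).symm.toLinearMap,
        fun h => hx ?_⟩
      have h1 : (unopLinearEquiv A).symm 1 • x = 0 := LinearMap.congr_fun h 1
      exact (one_smul Aᵐᵒᵖ x).symm.trans h1)
    (d₀ := (LinearMap.range (bongartzMap P.d₁ f)).mkQ.prodMap P.d₀)
    ((Submodule.mkQ_surjective _).prodMap P.surjective)
    (ker_prodMap_eq_range (Submodule.ker_mkQ _).symm P.exact) hVT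
  rw [← hT.2] at hle
  -- `|T| = |V ⊕ T|` is finite, so the summands of `V ⊕ T` are those of `T`
  choose φ hφ using exists_indecomposableSummand_of_retract (LinearMap.inr Aᵐᵒᵖ V T)
    (LinearMap.snd Aᵐᵒᵖ V T) (LinearMap.snd_comp_inr _ _ _)
  let Φ : Quotient (isoSetoid Aᵐᵒᵖ T) → Quotient (isoSetoid Aᵐᵒᵖ (V × T)) :=
    Quotient.map φ fun a b ⟨e⟩ => ⟨((hφ a).some.symm.trans e).trans (hφ b).some⟩
  have hΦ : Function.Injective Φ := by
    intro a b
    induction a using Quotient.inductionOn with | _ a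
    induction b using Quotient.inductionOn with | _ b
    intro h
    obtain ⟨e⟩ := Quotient.exact h
    exact Quotient.sound ⟨((hφ a).some.trans e).trans (hφ b).some.symm⟩
  have hfin : Finite (Quotient (isoSetoid Aᵐᵒᵖ (V × T))) := by
    by_contra hinf
    rw [not_finite_iff_infinite] at hinf
    exact hne ENat.card_eq_top_of_infinite
  have := Finite.of_injective Φ hΦ
  have hsurj : Function.Surjective Φ := by
    refine (hΦ.bijective_of_nat_card_le ?_).2
    rw [numIndecomposableSummands, numIndecomposableSummands, ENat.card_eq_coe_natCard,
      ENat.card_eq_coe_natCard] at hle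
    exact_mod_cast hle
  have hVT : MemFac Aᵐᵒᵖ T V := by
    obtain ⟨s, hs, hsup⟩ := exists_finset_sup_eq (⊤ : Submodule Aᵐᵒᵖ V) ⟨⊥, isCompl_top_bot⟩
    have h1 : MemFac Aᵐᵒᵖ T (s.sup id : Submodule Aᵐᵒᵖ V) := by
      refine memFac_finset_sup s fun L hL => ?_
      obtain ⟨L', ⟨e⟩⟩ := exists_indecomposableSummand_of_retract (LinearMap.inl Aᵐᵒᵖ V T)
        (LinearMap.fst Aᵐᵒᵖ V T) (LinearMap.fst_comp_inl _ _ _) ⟨L, hs L hL⟩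
      obtain ⟨a, ha⟩ := hsurj (Quotient.mk _ L')
      induction a using Quotient.inductionOn with | _ a
      obtain ⟨e'⟩ := Quotient.exact ha
      let e'' := ((hφ a).some.trans e').trans e.symm
      obtain ⟨N', hc⟩ := a.2.2
      refine ⟨1, e''.toLinearMap ∘ₗ a.1.projectionOnto N' hc ∘ₗ LinearMap.proj 0,
        e''.surjective.comp (fun y => ⟨fun _ => y, ?_⟩)⟩
      simp
    rw [hsup] at h1
    exact h1.of_surjective Submodule.topEquiv.toLinearMap (LinearEquiv.surjective _)
  exact hVT.trans (hX.memFac_bongartzComplement f)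

end TauTilting

/-! ### Vanishing of extension groups in exact sequences -/

section ExtVanishing

open Abelian

variable {C : Type*} [Category* C] [Abelian C] [HasExt.{u} C] {S : ShortComplex C}
  (hS : S.ShortExact) {X Y Z : C} {n : ℕ}

theorem subsingleton_ext_of_retract_left (r : Retract X Y) (h : Subsingleton (Ext.{u} Y Z n)) :
    Subsingleton (Ext.{u} X Z n) := by
  refine subsingleton_of_forall_eq 0 fun e => ?_
  have h0 : (Ext.mk₀ r.r).comp e (zero_add n) = 0 := Subsingleton.elim _ _
  have := congrArg (fun t => (Ext.mk₀ r.i).comp t (zero_add n)) h0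
  simpa [Ext.mk₀_comp_mk₀_assoc] using this

theorem subsingleton_ext_of_retract_right (r : Retract X Y) (h : Subsingleton (Ext.{u} Z Y n)) :
    Subsingleton (Ext.{u} Z X n) := by
  refine subsingleton_of_forall_eq 0 fun e => ?_
  have h0 : e.comp (Ext.mk₀ r.i) (add_zero n) = 0 := Subsingleton.elim _ _
  have := congrArg (fun t => t.comp (Ext.mk₀ r.r) (add_zero n)) h0
  simpa [Ext.comp_assoc_of_third_deg_zero] using this

include hS

theorem subsingleton_ext_X₁_right (h₂ : Subsingleton (Ext.{u} X S.X₂ (n + 1)))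
    (h₃ : Subsingleton (Ext.{u} X S.X₃ n)) : Subsingleton (Ext.{u} X S.X₁ (n + 1)) := by
  refine subsingleton_of_forall_eq 0 fun e => ?_
  obtain ⟨x, rfl⟩ := Ext.covariant_sequence_exact₁ X hS e (Subsingleton.elim _ _) rfl
  rw [Subsingleton.elim x 0, Ext.zero_comp]

theorem subsingleton_ext_X₁_right_one (h₂ : Subsingleton (Ext.{u} X S.X₂ 1))
    (h₃ : ∀ φ : X ⟶ S.X₃, ∃ ψ : X ⟶ S.X₂, ψ ≫ S.g = φ) : Subsingleton (Ext.{u} X S.X₁ 1) := by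
  refine subsingleton_of_forall_eq 0 fun e => ?_
  obtain ⟨x, rfl⟩ := Ext.covariant_sequence_exact₁ X hS e (Subsingleton.elim _ _) (zero_add 1)
  obtain ⟨φ, rfl⟩ := (Ext.mk₀_bijective X S.X₃).2 x
  obtain ⟨ψ, rfl⟩ := h₃ φ
  rw [← Ext.mk₀_comp_mk₀, Ext.comp_assoc_of_second_deg_zero, hS.comp_extClass, Ext.comp_zero]

theorem subsingleton_ext_X₁_left (h₂ : Subsingleton (Ext.{u} S.X₂ Y n))
    (h₃ : Subsingleton (Ext.{u} S.X₃ Y (n + 1))) : Subsingleton (Ext.{u} S.X₁ Y n) := by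
  refine subsingleton_of_forall_eq 0 fun e => ?_
  obtain ⟨x, rfl⟩ := Ext.contravariant_sequence_exact₁ hS Y e (add_comm 1 n)
    (Subsingleton.elim _ _)
  rw [Subsingleton.elim x 0, Ext.comp_zero]

theorem subsingleton_ext_X₃_right (h₂ : Subsingleton (Ext.{u} X S.X₂ n))
    (h₁ : Subsingleton (Ext.{u} X S.X₁ (n + 1))) : Subsingleton (Ext.{u} X S.X₃ n) := by
  refine subsingleton_of_forall_eq 0 fun e => ?_
  obtain ⟨x, rfl⟩ := Ext.covariant_sequence_exact₃ X hS e rfl (Subsingleton.elim _ _)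
  rw [Subsingleton.elim x 0, Ext.zero_comp]

theorem subsingleton_ext_X₃_left (h₂ : Subsingleton (Ext.{u} S.X₂ Y (n + 1)))
    (h₁ : Subsingleton (Ext.{u} S.X₁ Y n)) : Subsingleton (Ext.{u} S.X₃ Y (n + 1)) := by
  refine subsingleton_of_forall_eq 0 fun e => ?_
  obtain ⟨x, rfl⟩ := Ext.contravariant_sequence_exact₃ hS Y e (Subsingleton.elim _ _)
    (add_comm 1 n)
  rw [Subsingleton.elim x 0, Ext.comp_zero]

theorem subsingleton_ext_X₃_left_one (h₂ : Subsingleton (Ext.{u} S.X₂ Y 1))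
    (h₁ : ∀ φ : S.X₁ ⟶ Y, ∃ ψ : S.X₂ ⟶ Y, S.f ≫ ψ = φ) : Subsingleton (Ext.{u} S.X₃ Y 1) := by
  refine subsingleton_of_forall_eq 0 fun e => ?_
  obtain ⟨x, rfl⟩ := Ext.contravariant_sequence_exact₃ hS Y e (Subsingleton.elim _ _) (add_zero 1)
  obtain ⟨φ, rfl⟩ := (Ext.mk₀_bijective S.X₁ Y).2 x
  obtain ⟨ψ, rfl⟩ := h₁ φ
  rw [← Ext.mk₀_comp_mk₀, ← Ext.comp_assoc_of_second_deg_zero, hS.extClass_comp, Ext.zero_comp]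

theorem exists_section_of_subsingleton_ext (h : Subsingleton (Ext.{u} S.X₃ S.X₁ 1)) :
    ∃ s : S.X₃ ⟶ S.X₂, s ≫ S.g = 𝟙 S.X₃ := by
  obtain ⟨x, hx⟩ := Ext.covariant_sequence_exact₃ S.X₃ hS (Ext.mk₀ (𝟙 S.X₃)) (zero_add 1)
    (Subsingleton.elim _ _)
  obtain ⟨s, rfl⟩ := (Ext.mk₀_bijective S.X₃ S.X₂).2 x
  rw [Ext.mk₀_comp_mk₀] at hx
  exact ⟨s, (Ext.mk₀_bijective S.X₃ S.X₃).1 hx⟩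

theorem exists_retraction_of_subsingleton_ext (h : Subsingleton (Ext.{u} S.X₃ S.X₁ 1)) :
    ∃ r : S.X₂ ⟶ S.X₁, S.f ≫ r = 𝟙 S.X₁ := by
  obtain ⟨x, hx⟩ := Ext.contravariant_sequence_exact₁ hS S.X₁ (Ext.mk₀ (𝟙 S.X₁)) (add_zero 1)
    (Subsingleton.elim _ _)
  obtain ⟨s, rfl⟩ := (Ext.mk₀_bijective S.X₂ S.X₁).2 x
  rw [Ext.mk₀_comp_mk₀] at hx
  exact ⟨s, (Ext.mk₀_bijective S.X₁ S.X₁).1 hx⟩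

end ExtVanishing

/-! ### Vanishing of extension groups of modules -/

section ModuleExt

open Abelian

variable {R : Type u} [Ring R]

theorem subsingleton_ext_pi_left (T : Type u) [AddCommGroup T] [Module R T] (m n : ℕ)
    (X : ModuleCat.{u} R) (h : Subsingleton (Ext.{u} (ModuleCat.of R T) X n)) :
    Subsingleton (Ext.{u} (ModuleCat.of R (Fin m → T)) X n) := by
  refine subsingleton_of_forall_eq 0 fun e => ?_
  have hid : 𝟙 (ModuleCat.of R (Fin m → T)) =
      ∑ i : Fin m, ModuleCat.ofHom (LinearMap.proj (R := R) (φ := fun _ : Fin m => T) i) ≫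
        ModuleCat.ofHom (LinearMap.single R (fun _ : Fin m => T) i) := by
    ext x j
    simp [ModuleCat.hom_sum, Pi.single_apply]
  rw [← Ext.mk₀_id_comp e, hid, Ext.mk₀_sum, Ext.sum_comp]
  refine Finset.sum_eq_zero fun i _ => ?_
  rw [← Ext.mk₀_comp_mk₀, Ext.comp_assoc_of_second_deg_zero,
    Subsingleton.elim ((Ext.mk₀ (ModuleCat.ofHom (LinearMap.single R (fun _ => T) i))).comp e _) 0,
    Ext.comp_zero]

theorem subsingleton_ext_pi_right (U : Type u) [AddCommGroup U] [Module R U] (m n : ℕ)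
    (X : ModuleCat.{u} R) (h : Subsingleton (Ext.{u} X (ModuleCat.of R U) n)) :
    Subsingleton (Ext.{u} X (ModuleCat.of R (Fin m → U)) n) := by
  refine subsingleton_of_forall_eq 0 fun e => ?_
  have hid : 𝟙 (ModuleCat.of R (Fin m → U)) =
      ∑ i : Fin m, ModuleCat.ofHom (LinearMap.proj (R := R) (φ := fun _ : Fin m => U) i) ≫
        ModuleCat.ofHom (LinearMap.single R (fun _ : Fin m => U) i) := by
    ext x j
    simp [ModuleCat.hom_sum, Pi.single_apply]
  rw [← Ext.comp_mk₀_id e, hid, Ext.mk₀_sum, Ext.comp_sum]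
  refine Finset.sum_eq_zero fun i _ => ?_
  rw [← Ext.mk₀_comp_mk₀, ← Ext.comp_assoc_of_third_deg_zero,
    Subsingleton.elim (e.comp (Ext.mk₀ (ModuleCat.ofHom
      (LinearMap.proj (R := R) (φ := fun _ : Fin m => U) i))) _) 0,
    Ext.zero_comp]

theorem retract_prod_left (M N : Type u) [AddCommGroup M] [Module R M] [AddCommGroup N]
    [Module R N] : Nonempty (Retract (ModuleCat.of R M) (ModuleCat.of R (M × N))) :=
  ⟨⟨ModuleCat.ofHom (LinearMap.inl R M N), ModuleCat.ofHom (LinearMap.fst R M N), by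
    ext; rfl⟩⟩

theorem retract_prod_right (M N : Type u) [AddCommGroup M] [Module R M] [AddCommGroup N]
    [Module R N] : Nonempty (Retract (ModuleCat.of R N) (ModuleCat.of R (M × N))) :=
  ⟨⟨ModuleCat.ofHom (LinearMap.inr R M N), ModuleCat.ofHom (LinearMap.snd R M N), by
    ext; rfl⟩⟩

/-- The short complex `N → E → E / i(N)`. -/
abbrev shortComplexQuotient {N E : Type u} [AddCommGroup N] [Module R N] [AddCommGroup E]
    [Module R E] (i : N →ₗ[R] E) : ShortComplex (ModuleCat.{u} R) :=
  ModuleCat.shortComplexOfCompEqZero i (LinearMap.range i).mkQ (by ext; simp)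

theorem shortExact_shortComplexQuotient {N E : Type u} [AddCommGroup N] [Module R N]
    [AddCommGroup E] [Module R E] {i : N →ₗ[R] E} (hi : Function.Injective i) :
    (shortComplexQuotient i).ShortExact :=
  ModuleCat.shortComplex_shortExact _ (LinearMap.exact_map_mkQ_range i) hi
    (Submodule.mkQ_surjective _)

end ModuleExt

/-! ### Resolutions by powers of a module, and their images under Hom -/

section HomFrom

open Abelian

variable (R : Type u) [Ring R] (T : Type u) [AddCommGroup T] [Module R T]

/-- `Hom_R(T, M)` as an object of the category of right `End_R(T)`-modules. -/
noncomputable def homFrom (M : Type u) [AddCommGroup M] [Module R M] :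
    ModuleCat.{u} (Module.End R T)ᵐᵒᵖ :=
  letI := homRightEndModule R T M
  ModuleCat.of (Module.End R T)ᵐᵒᵖ (T →ₗ[R] M)

variable {M N : Type u} [AddCommGroup M] [Module R M] [AddCommGroup N] [Module R N]

/-- The homomorphism of right `End_R(T)`-modules `Hom_R(T, M) → Hom_R(T, N)` induced by
`f : M → N`. -/
noncomputable def homFromMap (f : M →ₗ[R] N) : homFrom R T M ⟶ homFrom R T N :=
  letI := homRightEndModule R T M
  letI := homRightEndModule R T N
  ModuleCat.ofHom
    { toFun := fun g => f ∘ₗ g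
      map_add' := fun _ _ => LinearMap.comp_add _ _ _
      map_smul' := fun _ _ => rfl }

theorem projective_homFrom_pi (m : ℕ) : Projective (homFrom R T (Fin m → T)) := by
  let _ := homRightEndModule R T (Fin m → T)
  let e : (T →ₗ[R] (Fin m → T)) ≃ₗ[(Module.End R T)ᵐᵒᵖ] (Fin m → (Module.End R T)ᵐᵒᵖ) :=
    { toFun := fun f i => MulOpposite.op (LinearMap.proj i ∘ₗ f)
      map_add' := fun _ _ => rfl
      map_smul' := fun _ _ => rfl
      invFun := fun g => LinearMap.pi fun i => (g i).unop
      left_inv := fun _ => rfl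
      right_inv := fun _ => rfl }
  have : Module.Projective (Module.End R T)ᵐᵒᵖ (T →ₗ[R] (Fin m → T)) :=
    Module.Projective.of_equiv e.symm
  exact (IsProjective.iff_projective _).1 this

/-- Let `W` be a class of modules each of which has a right `add T`-approximation that is onto and
has its kernel in `W`, with `Extⁱ(T, W) = 0` for `1 ≤ i ≤ n`. If `M ∈ W` and `Extⁿ⁺¹(M, W) = 0`,
then `pd Hom(T, M) ≤ n`: iterating approximations resolves `M` by modules in `add T`, dimension
shifting shows that the `n`-th syzygy splits off, and `Hom(T, -)` keeps the resolution exact. -/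
theorem hasProjectiveDimensionLT_homFrom (W : ModuleCat.{u} R → Prop)
    (happ : ∀ (M : Type u) [AddCommGroup M] [Module R M], W (ModuleCat.of R M) →
      ∃ (m : ℕ) (p : (Fin m → T) →ₗ[R] M), Function.Surjective p ∧
        W (ModuleCat.of R (LinearMap.ker p)) ∧ ∀ f : T →ₗ[R] M, ∃ f', p ∘ₗ f' = f)
    (n : ℕ) (hT : ∀ X, W X → ∀ i, 1 ≤ i → i ≤ n → Subsingleton (Ext.{u} (ModuleCat.of R T) X i))
    (M : Type u) [AddCommGroup M] [Module R M] (hM : W (ModuleCat.of R M))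
    (hext : ∀ X, W X → Subsingleton (Ext.{u} (ModuleCat.of R M) X (n + 1))) :
    HasProjectiveDimensionLT (homFrom R T M) (n + 1) := by
  induction n generalizing M with
  | zero =>
    obtain ⟨m, p, hp, hL, -⟩ := happ M hM
    obtain ⟨s, hs⟩ := exists_section_of_subsingleton_ext (LinearMap.shortExact_shortComplexKer hp)
      (hext _ hL)
    have hs' (x : M) : p (s.hom x) = x := LinearMap.congr_fun (congrArg ModuleCat.Hom.hom hs) x
    have := projective_homFrom_pi R T m
    have r : Retract (homFrom R T M) (homFrom R T (Fin m → T)) :=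
      ⟨homFromMap R T s.hom, homFromMap R T p,
        ModuleCat.hom_ext (LinearMap.ext fun f : T →ₗ[R] M =>
          LinearMap.ext (f := p ∘ₗ s.hom ∘ₗ f) (g := f) fun x => hs' (f x))⟩
    exact r.hasProjectiveDimensionLT 1
  | succ n ih =>
    obtain ⟨m, p, hp, hL, hlift⟩ := happ M hM
    have hS := LinearMap.shortExact_shortComplexKer hp
    have hpd := ih (fun X hX i h1 hi => hT X hX i h1 (by omega)) (LinearMap.ker p) hL
      fun X hX => subsingleton_ext_X₁_left hS
        (subsingleton_ext_pi_left T m _ X (hT X hX (n + 1) (by omega) le_rfl)) (hext X hX)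
    have hzero : homFromMap R T (LinearMap.ker p).subtype ≫ homFromMap R T p = 0 :=
      ModuleCat.hom_ext (LinearMap.ext fun f : T →ₗ[R] LinearMap.ker p =>
        LinearMap.ext (f := p ∘ₗ (LinearMap.ker p).subtype ∘ₗ f) (g := 0) fun x => (f x).2)
    have hS' : (ShortComplex.mk _ _ hzero).ShortExact := by
      refine ModuleCat.shortComplex_shortExact _ ?_ ?_ hlift
      · intro f
        constructor
        · intro hf
          exact ⟨LinearMap.codRestrict (LinearMap.ker p) f fun x => LinearMap.congr_fun hf x, rfl⟩
        · rintro ⟨g, rfl⟩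
          exact LinearMap.congr_fun (congrArg ModuleCat.Hom.hom hzero) g
      · intro f g hfg
        exact LinearMap.ext fun x => Subtype.ext (LinearMap.congr_fun hfg x)
    have := projective_homFrom_pi R T m
    have h2 : HasProjectiveDimensionLT (homFrom R T (Fin m → T)) 1 := inferInstance
    exact hS'.hasProjectiveDimensionLT_X₃ (n + 1) hpd
      (hasProjectiveDimensionLT_of_ge (homFrom R T (Fin m → T)) 1 (n + 1 + 1) (by omega))

end HomFrom

section HomTo

open Abelian

variable (R : Type u) [Ring R] (U : Type u) [AddCommGroup U] [Module R U]

/-- `Hom_R(N, U)` as an object of the category of left `End_R(U)`-modules. -/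
noncomputable abbrev homTo (N : Type u) [AddCommGroup N] [Module R N] :
    ModuleCat.{u} (Module.End R U) :=
  ModuleCat.of (Module.End R U) (N →ₗ[R] U)

variable {M N : Type u} [AddCommGroup M] [Module R M] [AddCommGroup N] [Module R N]

/-- The homomorphism of left `End_R(U)`-modules `Hom_R(N, U) → Hom_R(M, U)` induced by
`f : M → N`. -/
noncomputable def homToMap (f : M →ₗ[R] N) : homTo R U N ⟶ homTo R U M :=
  ModuleCat.ofHom
    { toFun := fun g => g ∘ₗ f
      map_add' := fun _ _ => rfl
      map_smul' := fun _ _ => rfl }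

theorem projective_homTo_pi (m : ℕ) : Projective (homTo R U (Fin m → U)) := by
  let e : ((Fin m → U) →ₗ[R] U) ≃ₗ[Module.End R U] (Fin m → Module.End R U) :=
    { toFun := fun f i => f ∘ₗ LinearMap.single R (fun _ => U) i
      map_add' := fun _ _ => rfl
      map_smul' := fun _ _ => rfl
      invFun := fun g => ∑ i, g i ∘ₗ LinearMap.proj i
      left_inv := fun f => by
        ext i x
        simp [Pi.single_apply, apply_ite]
      right_inv := fun g => by
        ext i x
        simp [Pi.single_apply, apply_ite] }
  have : Module.Projective (Module.End R U) ((Fin m → U) →ₗ[R] U) :=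
    Module.Projective.of_equiv e.symm
  exact (IsProjective.iff_projective _).1 this

/-- The dual of `hasProjectiveDimensionLT_homFrom`, for left `add U`-approximations. -/
theorem hasProjectiveDimensionLT_homTo (W : ModuleCat.{u} R → Prop)
    (happ : ∀ (N : Type u) [AddCommGroup N] [Module R N], W (ModuleCat.of R N) →
      ∃ (m : ℕ) (i : N →ₗ[R] (Fin m → U)), Function.Injective i ∧
        W (ModuleCat.of R ((Fin m → U) ⧸ LinearMap.range i)) ∧
        ∀ f : N →ₗ[R] U, ∃ f', f' ∘ₗ i = f)
    (n : ℕ) (hU : ∀ X, W X → ∀ i, 1 ≤ i → i ≤ n → Subsingleton (Ext.{u} X (ModuleCat.of R U) i))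
    (N : Type u) [AddCommGroup N] [Module R N] (hN : W (ModuleCat.of R N))
    (hext : ∀ X, W X → Subsingleton (Ext.{u} X (ModuleCat.of R N) (n + 1))) :
    HasProjectiveDimensionLT (homTo R U N) (n + 1) := by
  induction n generalizing N with
  | zero =>
    obtain ⟨m, i, hi, hL, -⟩ := happ N hN
    obtain ⟨s, hs⟩ := exists_retraction_of_subsingleton_ext (shortExact_shortComplexQuotient hi)
      (hext _ hL)
    have hs' (x : N) : s.hom (i x) = x := LinearMap.congr_fun (congrArg ModuleCat.Hom.hom hs) x
    have := projective_homTo_pi R U m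
    have r : Retract (homTo R U N) (homTo R U (Fin m → U)) :=
      ⟨homToMap R U s.hom, homToMap R U i,
        ModuleCat.hom_ext (LinearMap.ext fun f : N →ₗ[R] U =>
          LinearMap.ext (f := (f ∘ₗ s.hom) ∘ₗ i) (g := f) fun x => congrArg f (hs' x))⟩
    exact r.hasProjectiveDimensionLT 1
  | succ n ih =>
    obtain ⟨m, i, hi, hL, hlift⟩ := happ N hN
    have hS := shortExact_shortComplexQuotient hi
    have hpd := ih (fun X hX i h1 hi => hU X hX i h1 (by omega)) _ hL
      fun X hX => subsingleton_ext_X₃_right hS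
        (subsingleton_ext_pi_right U m _ X (hU X hX (n + 1) (by omega) le_rfl)) (hext X hX)
    have hzero : homToMap R U (LinearMap.range i).mkQ ≫ homToMap R U i = 0 := by
      refine ModuleCat.hom_ext (LinearMap.ext fun f : _ ⧸ LinearMap.range i →ₗ[R] U =>
        LinearMap.ext (f := (f ∘ₗ (LinearMap.range i).mkQ) ∘ₗ i) (g := 0) fun x => ?_)
      have : (LinearMap.range i).mkQ (i x) = 0 := (Submodule.Quotient.mk_eq_zero _).2 ⟨x, rfl⟩
      exact (congrArg f this).trans (map_zero f)
    have hS' : (ShortComplex.mk _ _ hzero).ShortExact := by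
      refine ModuleCat.shortComplex_shortExact _ ?_ ?_ hlift
      · intro f
        constructor
        · intro hf
          refine ⟨(LinearMap.range i).liftQ f ?_, LinearMap.ext fun x => rfl⟩
          rintro _ ⟨x, rfl⟩
          exact LinearMap.congr_fun hf x
        · rintro ⟨g, rfl⟩
          exact LinearMap.congr_fun (congrArg ModuleCat.Hom.hom hzero) g
      · intro f g hfg
        refine LinearMap.ext fun x => ?_
        obtain ⟨x, rfl⟩ := Submodule.Quotient.mk_surjective _ x
        exact LinearMap.congr_fun hfg x
    have := projective_homTo_pi R U m
    have h2 : HasProjectiveDimensionLT (homTo R U (Fin m → U)) 1 := inferInstance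
    exact hS'.hasProjectiveDimensionLT_X₃ (n + 1) hpd
      (hasProjectiveDimensionLT_of_ge (homTo R U (Fin m → U)) 1 (n + 1 + 1) (by omega))

end HomTo

/-! ### First extension groups -/

section FirstExt

open Abelian

variable {R : Type u} [Ring R]

/-- `Ext¹(T, L) = 0` if homomorphisms to `L` extend along a projective presentation of `T`. -/
theorem ExtendsAlong.subsingleton_ext_one {P₁ P₀ T L : Type u} [AddCommGroup P₁] [Module R P₁]
    [AddCommGroup P₀] [Module R P₀] [AddCommGroup T] [Module R T] [AddCommGroup L] [Module R L]
    {d : P₁ →ₗ[R] P₀} {d₀ : P₀ →ₗ[R] T} [Module.Projective R P₀] (hd₀ : Function.Surjective d₀)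
    (hex : LinearMap.range d = LinearMap.ker d₀) (hL : ExtendsAlong d L) :
    Subsingleton (Ext.{u} (ModuleCat.of R T) (ModuleCat.of R L) 1) := by
  obtain ⟨J⟩ := EnoughInjectives.presentation (ModuleCat.of R L)
  have hinj : Function.Injective J.f.hom := (ModuleCat.mono_iff_injective _).1 J.mono
  have := J.injective
  refine subsingleton_ext_X₁_right_one (shortExact_shortComplexQuotient hinj)
    (Ext.subsingleton_of_injective _ J.J 0) fun φ => ?_
  obtain ⟨ψ, hψ⟩ := exists_lift_of_extendsAlong hd₀ hex (LinearMap.range J.f.hom).mkQ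
    (Submodule.mkQ_surjective _) (by
      rw [Submodule.ker_mkQ]
      exact hL.of_linearEquiv (LinearEquiv.ofInjective J.f.hom hinj)) φ.hom
  exact ⟨ModuleCat.ofHom ψ, ModuleCat.hom_ext hψ⟩

/-- `Ext¹(Y, U) = 0` if homomorphisms to `U` extend along all monomorphisms with cokernel `Y`. -/
theorem subsingleton_ext_one_of_extend {U Y : Type u} [AddCommGroup U] [Module R U]
    [AddCommGroup Y] [Module R Y]
    (h : ∀ (E : Type u) [AddCommGroup E] [Module R E] (p : E →ₗ[R] Y), Function.Surjective p →
      ∀ φ : LinearMap.ker p →ₗ[R] U, ∃ ψ : E →ₗ[R] U, ψ ∘ₗ (LinearMap.ker p).subtype = φ) :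
    Subsingleton (Ext.{u} (ModuleCat.of R Y) (ModuleCat.of R U) 1) := by
  let p := Finsupp.linearCombination R (id : Y → Y)
  have hp : Function.Surjective p := Finsupp.linearCombination_id_surjective R Y
  have : Projective (ModuleCat.of R (Y →₀ R)) := (IsProjective.iff_projective _).1 inferInstance
  refine subsingleton_ext_X₃_left_one (LinearMap.shortExact_shortComplexKer hp)
    (HasProjectiveDimensionLT.subsingleton _ 1 1 le_rfl _) fun φ => ?_
  obtain ⟨ψ, hψ⟩ := h _ p hp φ.hom
  exact ⟨ModuleCat.ofHom ψ, ModuleCat.hom_ext hψ⟩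

end FirstExt

/-! ### Comparison of dimensions -/

section Dimension

variable {R : Type u} [Ring R]

/-- The bottom value, the dimension of the zero module, needs a separate comparison. -/
theorem le_of_forall_natCast {x y : WithBot ℕ∞} (hbot : y = ⊥ → x = ⊥)
    (h : ∀ n : ℕ, y = n → x ≤ n) : x ≤ y := by
  induction y with
  | bot => exact (hbot rfl).le
  | coe y =>
    induction y with
    | top => exact le_top
    | coe n => exact h n rfl

theorem subsingleton_of_isZero {M : Type u} [AddCommGroup M] [Module R M]
    (h : Limits.IsZero (ModuleCat.of R M)) : Subsingleton M :=
  ModuleCat.subsingleton_of_isZero h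

theorem pdHomFrom_le {T M : Type u} [AddCommGroup T] [Module R T] [AddCommGroup M] [Module R M]
    (h : ∀ n : ℕ, pd R M = n → HasProjectiveDimensionLT (ModuleCat.of R M) (n + 1) →
      HasProjectiveDimensionLT (homFrom R T M) (n + 1)) : pdHomFrom R T M ≤ pd R M := by
  refine le_of_forall_natCast (fun hbot => ?_) fun n hn => ?_
  · have := subsingleton_of_isZero ((projectiveDimension_eq_bot_iff _).1 hbot)
    refine (projectiveDimension_eq_bot_iff (homFrom R T M)).2 ?_
    have : Subsingleton (homFrom R T M) := inferInstanceAs (Subsingleton (T →ₗ[R] M))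
    exact ModuleCat.isZero_of_subsingleton _
  · exact (projectiveDimension_le_iff (homFrom R T M) n).2
      (h n hn ((projectiveDimension_le_iff _ n).1 hn.le))

theorem pdHomTo_le {U N : Type u} [AddCommGroup U] [Module R U] [AddCommGroup N] [Module R N]
    (h : ∀ n : ℕ, injd R N = n → HasInjectiveDimensionLT (ModuleCat.of R N) (n + 1) →
      HasProjectiveDimensionLT (homTo R U N) (n + 1)) : pdHomTo R N U ≤ injd R N := by
  refine le_of_forall_natCast (fun hbot => ?_) fun n hn => ?_
  · have := subsingleton_of_isZero ((injectiveDimension_eq_bot_iff _).1 hbot)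
    refine (projectiveDimension_eq_bot_iff (homTo R U N)).2 ?_
    have : Subsingleton (homTo R U N) := inferInstanceAs (Subsingleton (N →ₗ[R] U))
    exact ModuleCat.isZero_of_subsingleton _
  · exact (projectiveDimension_le_iff (homTo R U N) n).2
      (h n hn ((injectiveDimension_le_iff _ n).1 hn.le))

end Dimension

/-! ### Approximations by a τ-tilting module and its translate -/

section TorsionPair

variable (K : Type u) [Field K] {A : Type u} [Ring A] [Algebra K A] [Module.Finite K A]
  {T : Type u} [AddCommGroup T] [Module Aᵐᵒᵖ T] [Module.Finite Aᵐᵒᵖ T]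

/-- A module in `Fac T` is the target of a right `add T`-approximation that is onto; its kernel lies in
`Fac T` again, because `Fac T` consists of the modules `X` with `Hom(X, τ T) = 0`. -/
theorem IsTauTilting.exists_right_approximation (hT : IsTauTilting K A T) (M : Type u)
    [AddCommGroup M] [Module Aᵐᵒᵖ M] [Module.Finite Aᵐᵒᵖ M] (hM : MemFac Aᵐᵒᵖ T M) :
    ∃ (m : ℕ) (p : (Fin m → T) →ₗ[Aᵐᵒᵖ] M), Function.Surjective p ∧
      MemFac Aᵐᵒᵖ T (LinearMap.ker p) ∧ ∀ f : T →ₗ[Aᵐᵒᵖ] M, ∃ f', p ∘ₗ f' = f := by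
  have : IsArtinianRing Aᵐᵒᵖ := isArtinianRing_op K A
  have : Module.Finite K Aᵐᵒᵖ := finite_algebra_op K
  let _ : Module K T := Module.compHom T (algebraMap K Aᵐᵒᵖ)
  have : IsScalarTower K Aᵐᵒᵖ T := .of_algebraMap_smul fun _ _ => rfl
  let _ : Module K M := Module.compHom M (algebraMap K Aᵐᵒᵖ)
  have : IsScalarTower K Aᵐᵒᵖ M := .of_algebraMap_smul fun _ _ => rfl
  have := finite_restrictScalars K (R := Aᵐᵒᵖ) M
  obtain ⟨m, p, hp, -⟩ := exists_approximation K (⊤ : Submodule K (T →ₗ[Aᵐᵒᵖ] M))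
    (finite_hom (R := Aᵐᵒᵖ) K T M).fg_top
  have hlift (f : T →ₗ[Aᵐᵒᵖ] M) : ∃ f', p ∘ₗ f' = f := hp f trivial
  have hsurj : Function.Surjective p := by
    obtain ⟨n, g, hg⟩ := hM
    choose f' hf' using fun i => hlift (g ∘ₗ LinearMap.single Aᵐᵒᵖ (fun _ => T) i)
    intro x
    obtain ⟨y, rfl⟩ := hg x
    refine ⟨∑ i, f' i (y i), ?_⟩
    have h (i) : p (f' i (y i)) = g (Pi.single i (y i)) := LinearMap.congr_fun (hf' i) (y i)
    rw [map_sum]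
    simp only [h]
    rw [← map_sum, Finset.univ_sum_single]
  let P := minimalPresentation K A T
  have := P.projective₀
  refine ⟨m, p, hsurj, hT.memFac K A T _ ?_, hlift⟩
  exact ExtendsAlong.ker P.surjective P.exact p hT.1.extendsAlong.pi hlift

/-- Homomorphisms to `τ T` extend along monomorphisms `i` with `Hom(T, Coker i) = 0`. -/
theorem exists_extension_arTranslate {X Y : Type u} [AddCommGroup X] [Module Aᵐᵒᵖ X]
    [AddCommGroup Y] [Module Aᵐᵒᵖ Y] (i : X →ₗ[Aᵐᵒᵖ] Y) (hi : Function.Injective i)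
    (hc : ∀ f : T →ₗ[Aᵐᵒᵖ] Y ⧸ LinearMap.range i, f = 0)
    (φ : X →ₗ[Aᵐᵒᵖ] arTranslate K A T) : ∃ ψ : Y →ₗ[Aᵐᵒᵖ] arTranslate K A T, ψ ∘ₗ i = φ := by
  let P := minimalPresentation K A T
  refine (forall_exists_comp_eq_DTr_iff K P i).2 ?_ φ
  rintro g ⟨h, hh⟩
  have hh' (x) : h (P.d₁ x) = i (g x) := LinearMap.congr_fun hh x
  obtain ⟨f, hf⟩ := exists_comp_eq_of_ker_le P.surjective ((LinearMap.range i).mkQ ∘ₗ h) (by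
    rw [← P.exact]
    rintro _ ⟨x, rfl⟩
    refine (Submodule.Quotient.mk_eq_zero _).2 ?_
    rw [hh']
    exact ⟨g x, rfl⟩)
  have hmem (x) : h x ∈ LinearMap.range i := by
    refine (Submodule.Quotient.mk_eq_zero _).1 ?_
    rw [hc f] at hf
    exact (LinearMap.congr_fun hf x).symm
  let e := LinearEquiv.ofInjective i hi
  refine ⟨e.symm.toLinearMap ∘ₗ h.codRestrict _ hmem, ?_⟩
  ext x
  apply e.injective
  ext
  simp [e, hh']

theorem eq_zero_of_memSub (hT : IsTauRigid K A T) {N : Type u} [AddCommGroup N] [Module Aᵐᵒᵖ N]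
    (hN : MemSub Aᵐᵒᵖ (arTranslate K A T) N) (f : T →ₗ[Aᵐᵒᵖ] N) : f = 0 := by
  obtain ⟨n, i, hi⟩ := hN
  ext x
  apply hi
  rw [LinearMap.zero_apply, map_zero]
  ext1 j
  exact LinearMap.congr_fun (hT (LinearMap.proj j ∘ₗ i ∘ₗ f)) x

/-- For a `τ`-tilting module `T`, the homomorphisms `N → τ T` separate the points of a module `N`
with `Hom(T, N) = 0`: their common kernel lies in `Fac T`, hence is zero. -/
theorem IsTauTilting.eq_zero_of_forall (hT : IsTauTilting K A T) {N : Type u} [AddCommGroup N]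
    [Module Aᵐᵒᵖ N] [Module.Finite Aᵐᵒᵖ N] (hN : ∀ f : T →ₗ[Aᵐᵒᵖ] N, f = 0) (x : N)
    (hx : ∀ φ : N →ₗ[Aᵐᵒᵖ] arTranslate K A T, φ x = 0) : x = 0 := by
  have : IsArtinianRing Aᵐᵒᵖ := isArtinianRing_op K A
  let N' : Submodule Aᵐᵒᵖ N := ⨅ φ : N →ₗ[Aᵐᵒᵖ] arTranslate K A T, LinearMap.ker φ
  have hN' (y : N) : y ∈ N' ↔ ∀ φ : N →ₗ[Aᵐᵒᵖ] arTranslate K A T, φ y = 0 := by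
    simp [N']
  have hc (f : T →ₗ[Aᵐᵒᵖ] N ⧸ LinearMap.range N'.subtype) : f = 0 := by
    ext t
    obtain ⟨y, hy⟩ := Submodule.Quotient.mk_surjective _ (f t)
    rw [← hy]
    refine (Submodule.Quotient.mk_eq_zero _).2 ?_
    rw [Submodule.range_subtype, hN']
    intro φ
    have h0 := LinearMap.congr_fun (hT.1 ((LinearMap.range N'.subtype).liftQ φ (by
      rw [Submodule.range_subtype]
      exact fun z hz => (hN' z).1 hz φ) ∘ₗ f)) t
    rw [LinearMap.comp_apply, ← hy] at h0
    exact h0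
  have hE : ExtendsAlong (minimalPresentation K A T).d₁ N' := by
    refine (forall_hom_DTr_eq_zero_iff K (minimalPresentation K A T)).1 fun φ => ?_
    obtain ⟨ψ, hψ⟩ := exists_extension_arTranslate K N'.subtype N'.injective_subtype hc φ
    rw [← hψ]
    exact LinearMap.ext fun y => (hN' _).1 y.2 ψ
  obtain ⟨n, g, hg⟩ := hT.memFac K A T N' hE
  obtain ⟨y, hy⟩ := hg ⟨x, (hN' x).2 hx⟩
  have h0 : N'.subtype ∘ₗ g = 0 := LinearMap.pi_ext' fun i => by
    rw [LinearMap.zero_comp]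
    exact hN ((N'.subtype ∘ₗ g) ∘ₗ LinearMap.single Aᵐᵒᵖ (fun _ => T) i)
  have := LinearMap.congr_fun h0 y
  simpa [hy] using this

theorem finite_arTranslate : Module.Finite Aᵐᵒᵖ (arTranslate K A T) := by
  let P := minimalPresentation K A T
  have := P.finite₁
  have := finite_hom (R := Aᵐᵒᵖ) K P.P₁ A
  let I : Submodule A (P.P₁ →ₗ[Aᵐᵒᵖ] A) := LinearMap.range (LinearMap.lcomp A A P.d₁)
  have : Module.Finite K P.Transpose :=
    Module.Finite.of_surjective (I.mkQ.restrictScalars K) I.mkQ_surjective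
  let _ : Module K (P.DTr K) := Module.compHom (P.DTr K) (algebraMap K Aᵐᵒᵖ)
  have : IsScalarTower K Aᵐᵒᵖ (P.DTr K) := .of_algebraMap_smul fun _ _ => rfl
  let e : (P.Transpose →ₗ[K] K) →ₗ[K] P.DTr K :=
    { toFun := fun f => f
      map_add' := fun _ _ => rfl
      map_smul' := fun c f => LinearMap.ext fun x => by
        change c • f x = f (algebraMap K A c • x)
        rw [algebraMap_smul, map_smul] }
  have : Module.Finite K (P.DTr K) := Module.Finite.of_surjective e fun f => ⟨f, rfl⟩
  exact Module.Finite.of_restrictScalars_finite K Aᵐᵒᵖ (P.DTr K)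

/-- A finite-dimensional space of homomorphisms `N → U` consists of homomorphisms factoring
through a single homomorphism `N → Uᵐ`. -/
theorem exists_left_approximation {R : Type u} [Ring R] [Algebra K R] [Module.Finite K R]
    (N U : Type u) [AddCommGroup N] [Module R N] [Module.Finite R N] [AddCommGroup U] [Module R U]
    [Module.Finite R U] :
    ∃ (m : ℕ) (i : N →ₗ[R] (Fin m → U)), ∀ f : N →ₗ[R] U, ∃ f', f' ∘ₗ i = f := by
  let _ : Module K U := Module.compHom U (algebraMap K R)
  have : IsScalarTower K R U := .of_algebraMap_smul fun _ _ => rfl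
  have := finite_restrictScalars K (R := R) U
  obtain ⟨m, b, hb⟩ := Submodule.fg_iff_exists_fin_generating_family.1
    (finite_hom (R := R) K N U).fg_top
  refine ⟨m, LinearMap.pi b, fun f => ?_⟩
  have hf : f ∈ Submodule.span K (Set.range b) := hb ▸ Submodule.mem_top
  rw [Submodule.mem_span_range_iff_exists_fun] at hf
  obtain ⟨c, rfl⟩ := hf
  refine ⟨∑ k, c k • LinearMap.proj k, ?_⟩
  ext x
  simp

/-- A module `N` with `Hom(T, N) = 0` is the source of a left `add τT`-approximation that is a
monomorphism, and its cokernel `L` satisfies `Hom(T, L) = 0` again. -/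
theorem IsTauTilting.exists_left_approximation (hT : IsTauTilting K A T) (N : Type u)
    [AddCommGroup N] [Module Aᵐᵒᵖ N] [Module.Finite Aᵐᵒᵖ N] (hN : ∀ f : T →ₗ[Aᵐᵒᵖ] N, f = 0) :
    ∃ (m : ℕ) (i : N →ₗ[Aᵐᵒᵖ] (Fin m → arTranslate K A T)), Function.Injective i ∧
      (∀ f : T →ₗ[Aᵐᵒᵖ] (Fin m → arTranslate K A T) ⧸ LinearMap.range i, f = 0) ∧
      ∀ f : N →ₗ[Aᵐᵒᵖ] arTranslate K A T, ∃ f', f' ∘ₗ i = f := by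
  have : Module.Finite K Aᵐᵒᵖ := finite_algebra_op K
  have := finite_arTranslate K (A := A) (T := T)
  obtain ⟨m, i, hlift⟩ :=
    TauTilting.exists_left_approximation K (R := Aᵐᵒᵖ) N (arTranslate K A T)
  have hi : Function.Injective i := by
    refine (injective_iff_map_eq_zero i).2 fun x hx => hT.eq_zero_of_forall K hN x fun φ => ?_
    obtain ⟨f', rfl⟩ := hlift φ
    rw [LinearMap.comp_apply, hx, map_zero]
  refine ⟨m, i, hi, fun f => ?_, hlift⟩
  let P := minimalPresentation K A T
  have := P.projective₀
  have hdd (x) : P.d₀ (P.d₁ x) = 0 := by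
    rw [← LinearMap.mem_ker, ← P.exact]; exact ⟨x, rfl⟩
  obtain ⟨k, hk⟩ := Module.projective_lifting_property (LinearMap.range i).mkQ (f ∘ₗ P.d₀)
    (Submodule.mkQ_surjective _)
  have hk' (x) : (LinearMap.range i).mkQ (k x) = f (P.d₀ x) := LinearMap.congr_fun hk x
  let e := LinearEquiv.ofInjective i hi
  let g : P.P₁ →ₗ[Aᵐᵒᵖ] N := e.symm.toLinearMap ∘ₗ (k ∘ₗ P.d₁).codRestrict (LinearMap.range i)
    fun x => (Submodule.Quotient.mk_eq_zero _).1 (by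
      have := hk' (P.d₁ x)
      rwa [hdd, map_zero] at this)
  have hg (x) : i (g x) = k (P.d₁ x) := by
    have : e (g x) = _ := e.apply_symm_apply _
    exact congrArg Subtype.val this
  obtain ⟨h, hh⟩ := (forall_exists_comp_eq_DTr_iff K P i).1 hlift g
    ⟨k, LinearMap.ext fun x => (hg x).symm⟩
  have hh' (x) : h (P.d₁ x) = g x := LinearMap.congr_fun hh x
  obtain ⟨v, hv⟩ := exists_comp_eq_of_ker_le P.surjective (k - i ∘ₗ h) (by
    rw [← P.exact]
    rintro _ ⟨x, rfl⟩
    simp [hh', hg])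
  have hv0 : v = 0 := LinearMap.ext fun x => funext fun j =>
    LinearMap.congr_fun (hT.1 (LinearMap.proj j ∘ₗ v)) x
  rw [hv0, LinearMap.zero_comp] at hv
  ext x
  obtain ⟨y, rfl⟩ := P.surjective x
  rw [← hk']
  refine (Submodule.Quotient.mk_eq_zero _).2 ⟨h y, ?_⟩
  have := LinearMap.congr_fun hv y
  exact (sub_eq_zero.1 this.symm).symm

end TorsionPair

/-! ### The four inequalities -/

section Classes

open Abelian

variable (K : Type u) [Field K] {A : Type u} [Ring A] [Algebra K A] [Module.Finite K A]
  {T : Type u} [AddCommGroup T] [Module Aᵐᵒᵖ T] [Module.Finite Aᵐᵒᵖ T]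

/-- `Ext¹(T, Fac T) = 0` for a `τ`-rigid module `T`. -/
theorem IsTauRigid.subsingleton_ext_one (hT : IsTauRigid K A T) {X : Type u} [AddCommGroup X]
    [Module Aᵐᵒᵖ X] (hX : MemFac Aᵐᵒᵖ T X) :
    Subsingleton (Ext.{u} (ModuleCat.of Aᵐᵒᵖ T) (ModuleCat.of Aᵐᵒᵖ X) 1) := by
  let P := minimalPresentation K A T
  have := P.projective₀
  have := P.projective₁
  exact (hT.extendsAlong.of_memFac hX).subsingleton_ext_one P.surjective P.exact

/-- `Ext¹(Y, τ T) = 0` for all `Y` with `Hom(T, Y) = 0`. -/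
theorem subsingleton_ext_arTranslate_one {Y : Type u} [AddCommGroup Y] [Module Aᵐᵒᵖ Y]
    (hY : ∀ f : T →ₗ[Aᵐᵒᵖ] Y, f = 0) :
    Subsingleton (Ext.{u} (ModuleCat.of Aᵐᵒᵖ Y) (arTranslate K A T) 1) := by
  refine subsingleton_ext_one_of_extend (U := arTranslate K A T) fun E _ _ p hp φ => ?_
  refine exists_extension_arTranslate K (LinearMap.ker p).subtype
    (LinearMap.ker p).injective_subtype (fun f => ?_) φ
  let e : (E ⧸ LinearMap.range (LinearMap.ker p).subtype) ≃ₗ[Aᵐᵒᵖ] Y :=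
    (Submodule.quotEquivOfEq _ _ (Submodule.range_subtype _)).trans
      (p.quotKerEquivOfSurjective hp)
  ext x
  apply e.injective
  exact (LinearMap.congr_fun (hY (e.toLinearMap ∘ₗ f)) x).trans (map_zero e).symm

/-- The case `pd M ≤ 1` on the side of `Fac T`. -/
theorem IsTauTilting.pdHomFrom_le_of_pd_le_one (hT : IsTauTilting K A T) (M : Type u)
    [AddCommGroup M] [Module Aᵐᵒᵖ M] [Module.Finite Aᵐᵒᵖ M] (hM : MemFac Aᵐᵒᵖ T M)
    (hpd : pd Aᵐᵒᵖ M ≤ 1) : pdHomFrom Aᵐᵒᵖ T M ≤ pd Aᵐᵒᵖ M := by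
  have : IsArtinianRing Aᵐᵒᵖ := isArtinianRing_op K A
  refine pdHomFrom_le fun n hn hd => ?_
  have hn1 : n ≤ 1 := by
    rw [hn] at hpd
    exact_mod_cast hpd
  refine hasProjectiveDimensionLT_homFrom Aᵐᵒᵖ T
    (fun X => Module.Finite Aᵐᵒᵖ X ∧ MemFac Aᵐᵒᵖ T X) ?_ n ?_ M ⟨inferInstance, hM⟩
    fun X _ => hd.subsingleton _ _ _ le_rfl X
  · rintro L _ _ ⟨_, hL⟩
    obtain ⟨m, p, hp, hk, hlift⟩ := hT.exists_right_approximation K L hL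
    exact ⟨m, p, hp, ⟨inferInstance, hk⟩, hlift⟩
  · rintro X ⟨_, hX⟩ i h1 hi
    obtain rfl : i = 1 := by omega
    exact hT.1.subsingleton_ext_one K hX

/-- The case `Extⁱ(T, M ⊕ T) = 0` on the side of `Fac T`. -/
theorem IsTauTilting.pdHomFrom_le_of_extVanishes (hT : IsTauTilting K A T) (M : Type u)
    [AddCommGroup M] [Module Aᵐᵒᵖ M] [Module.Finite Aᵐᵒᵖ M] (hM : MemFac Aᵐᵒᵖ T M)
    (hext : ExtVanishes Aᵐᵒᵖ T (M × T)) : pdHomFrom Aᵐᵒᵖ T M ≤ pd Aᵐᵒᵖ M := by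
  have : IsArtinianRing Aᵐᵒᵖ := isArtinianRing_op K A
  refine pdHomFrom_le fun n _ hd => ?_
  refine hasProjectiveDimensionLT_homFrom Aᵐᵒᵖ T
    (fun X => (Module.Finite Aᵐᵒᵖ X ∧ MemFac Aᵐᵒᵖ T X) ∧
      ∀ i, 1 ≤ i → Subsingleton (Ext.{u} (ModuleCat.of Aᵐᵒᵖ T) X i)) ?_ n
    (fun X hX i h1 _ => hX.2 i h1) M ⟨⟨inferInstance, hM⟩, fun i hi =>
      subsingleton_ext_of_retract_right (retract_prod_left M T).some (hext i hi)⟩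
    fun X _ => hd.subsingleton _ _ _ le_rfl X
  rintro L _ _ ⟨⟨_, hL⟩, hLext⟩
  obtain ⟨m, p, hp, hk, hlift⟩ := hT.exists_right_approximation K L hL
  refine ⟨m, p, hp, ⟨⟨inferInstance, hk⟩, fun i hi => ?_⟩, hlift⟩
  match i, hi with
  | 1, _ => exact hT.1.subsingleton_ext_one K hk
  | j + 2, _ =>
    exact subsingleton_ext_X₁_right (LinearMap.shortExact_shortComplexKer hp)
      (subsingleton_ext_pi_right T m _ _ (subsingleton_ext_of_retract_right
        (retract_prod_right M T).some (hext (j + 2) (by omega)))) (hLext (j + 1) (by omega))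

/-- The case `id N ≤ 1` on the side of `Sub τT`. -/
theorem IsTauTilting.pdHomTo_le_of_injd_le_one (hT : IsTauTilting K A T) (N : Type u)
    [AddCommGroup N] [Module Aᵐᵒᵖ N] [Module.Finite Aᵐᵒᵖ N]
    (hN : MemSub Aᵐᵒᵖ (arTranslate K A T) N) (hid : injd Aᵐᵒᵖ N ≤ 1) :
    pdHomTo Aᵐᵒᵖ N (arTranslate K A T) ≤ injd Aᵐᵒᵖ N := by
  have := finite_arTranslate K (A := A) (T := T)
  refine pdHomTo_le fun n hn hd => ?_
  have hn1 : n ≤ 1 := by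
    rw [hn] at hid
    exact_mod_cast hid
  refine hasProjectiveDimensionLT_homTo Aᵐᵒᵖ (arTranslate K A T)
    (fun X => Module.Finite Aᵐᵒᵖ X ∧ ∀ f : T →ₗ[Aᵐᵒᵖ] X, f = 0) ?_ n ?_ N
    ⟨inferInstance, eq_zero_of_memSub K hT.1 hN⟩ fun X _ => hd.subsingleton _ _ _ le_rfl X
  · rintro L _ _ ⟨_, hL⟩
    obtain ⟨m, i, hi, hc, hlift⟩ := hT.exists_left_approximation K L hL
    exact ⟨m, i, hi, ⟨inferInstance, hc⟩, hlift⟩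
  · rintro X ⟨_, hX⟩ i h1 hi
    obtain rfl : i = 1 := by omega
    exact subsingleton_ext_arTranslate_one K hX

/-- The case `Extⁱ(N ⊕ τT, τT) = 0` on the side of `Sub τT`. -/
theorem IsTauTilting.pdHomTo_le_of_extVanishes (hT : IsTauTilting K A T) (N : Type u)
    [AddCommGroup N] [Module Aᵐᵒᵖ N] [Module.Finite Aᵐᵒᵖ N]
    (hN : MemSub Aᵐᵒᵖ (arTranslate K A T) N)
    (hext : ExtVanishes Aᵐᵒᵖ (N × arTranslate K A T) (arTranslate K A T)) :
    pdHomTo Aᵐᵒᵖ N (arTranslate K A T) ≤ injd Aᵐᵒᵖ N := by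
  have := finite_arTranslate K (A := A) (T := T)
  have hNext : ∀ i, 1 ≤ i →
      Subsingleton (Ext.{u} (ModuleCat.of Aᵐᵒᵖ N) (arTranslate K A T) i) := fun i hi =>
    subsingleton_ext_of_retract_left (retract_prod_left N (arTranslate K A T)).some (hext i hi)
  refine pdHomTo_le fun n _ hd => ?_
  refine hasProjectiveDimensionLT_homTo Aᵐᵒᵖ (arTranslate K A T)
    (fun X => (Module.Finite Aᵐᵒᵖ X ∧ ∀ f : T →ₗ[Aᵐᵒᵖ] X, f = 0) ∧
      ∀ i, 1 ≤ i → Subsingleton (Ext.{u} X (ModuleCat.of Aᵐᵒᵖ (arTranslate K A T)) i)) ?_ n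
    (fun X hX i h1 _ => hX.2 i h1) N ⟨⟨inferInstance, eq_zero_of_memSub K hT.1 hN⟩, hNext⟩
    fun X _ => hd.subsingleton _ _ _ le_rfl X
  rintro L _ _ ⟨⟨_, hL⟩, hLext⟩
  obtain ⟨m, i, hi, hc, hlift⟩ := hT.exists_left_approximation K L hL
  refine ⟨m, i, hi, ⟨⟨inferInstance, hc⟩, fun j hj => ?_⟩, hlift⟩
  match j, hj with
  | 1, _ => exact subsingleton_ext_arTranslate_one K hc
  | j + 2, _ =>
    exact subsingleton_ext_X₃_left (shortExact_shortComplexQuotient hi)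
      (subsingleton_ext_pi_left (arTranslate K A T) m _ _ (subsingleton_ext_of_retract_left
        (retract_prod_right (R := Aᵐᵒᵖ) N (arTranslate K A T)).some (hext (j + 2) (by omega))))
      (hLext (j + 1) (by omega))

end Classes

end TauTilting

theorem theorem0p3 (K : Type u) [Field K] [IsAlgClosed K]
    (A : Type u) [Ring A] [Algebra K A] [Module.Finite K A]
    (T : Type u) [AddCommGroup T] [Module Aᵐᵒᵖ T] [Module.Finite Aᵐᵒᵖ T]
    (hT : TauTilting.IsTauTilting K A T) :
    (∀ (M : Type u) [AddCommGroup M] [Module Aᵐᵒᵖ M] [Module.Finite Aᵐᵒᵖ M],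
      TauTilting.MemFac Aᵐᵒᵖ T M →
        (TauTilting.pd Aᵐᵒᵖ M ≤ 1 →
          TauTilting.pdHomFrom Aᵐᵒᵖ T M ≤ TauTilting.pd Aᵐᵒᵖ M) ∧
        (TauTilting.ExtVanishes Aᵐᵒᵖ T (M × T) →
          TauTilting.pdHomFrom Aᵐᵒᵖ T M ≤ TauTilting.pd Aᵐᵒᵖ M)) ∧
    (∀ (N : Type u) [AddCommGroup N] [Module Aᵐᵒᵖ N] [Module.Finite Aᵐᵒᵖ N],
      TauTilting.MemSub Aᵐᵒᵖ (TauTilting.arTranslate K A T) N →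
        (TauTilting.injd Aᵐᵒᵖ N ≤ 1 →
          TauTilting.pdHomTo Aᵐᵒᵖ N (TauTilting.arTranslate K A T) ≤ TauTilting.injd Aᵐᵒᵖ N) ∧
        (TauTilting.ExtVanishes Aᵐᵒᵖ (N × TauTilting.arTranslate K A T)
            (TauTilting.arTranslate K A T) →
          TauTilting.pdHomTo Aᵐᵒᵖ N (TauTilting.arTranslate K A T) ≤
            TauTilting.injd Aᵐᵒᵖ N)) :=
  ⟨fun M _ _ _ hM => ⟨hT.pdHomFrom_le_of_pd_le_one K M hM,
      hT.pdHomFrom_le_of_extVanishes K M hM⟩,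
    fun N _ _ _ hN => ⟨hT.pdHomTo_le_of_injd_le_one K N hN,
      hT.pdHomTo_le_of_extVanishes K N hN⟩⟩
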